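/- Let $T$ be the 3-regular infinite tree with a height function $h:V(T)\to\mathbb Z$ such that every vertex $x$ has exactly one neighbour (its parent) of height $h(x)+1$ and exactly two neighbours (its children) of height $h(x)-1$. The Diestel–Leader graph $\mathrm{DL}(2,2)$ has vertex set $\{(v_1,v_2)\in V(T)^2 : h(v_1)+h(v_2)=0\}$, and $(x_1,x_2)$, $(y_1,y_2)$ are adjacent if and only if $x_1y_1$ and $x_2y_2$ are both edges of $T$. A cycle $C$ of a graph $H$ is geodesic in $H$ if for any two points of $C$ at least one of the two arcs of $C$ between them is a shortest path in $H$. For $p\in[0,1]$, the FK-Ising measure of a finite graph $H=(V,E)$ gives a configuration $\omega\in\{0,1\}^E$ a probability proportional to $p^{o(\omega)}(1-p)^{|E|-o(\omega)}2^{k(\omega)}$, where $o(\omega)$ is the number of open edges and $k(\omega)$ the number of connected components of $(V,\{e:\omega(e)=1\})$. The free FK-Ising measure $\phi^f_{G,p}$ of an infinite countable graph $G$ is the weak limit of the FK-Ising measures of $G_n$ (edges outside $G_n$ being closed), where the limit is required to exist and be the same for all increasing sequences $(G_n)$ of finite subgraphs with union $G$. **Theorem.** Let $G=\mathrm{DL}(2,2)$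 and let $o$ be any vertex of $G$. 1. $1/\sqrt2<1$, and for every $p\in(1/\sqrt2,1]$, if $\omega_p$ is Bernoulli($p$) bond percolation on $G$, then with positive probability there are infinitely many cycles through $o$ that consist of open edges of $\omega_p$ and are geodesic both in $G$ and in the subgraph $\omega_p$. 2. $2/(\sqrt2+1)<1$, and for every $p\in(2/(\sqrt2+1),1]$, the free FK-Ising measure $\phi^f_{G,p}$ exists and is unique, and if $\omega_p$ is distributed according to it, then with positive probability there are infinitely many cycles through $o$ that consist of open edges of $\omega_p$ and are geodesic both in $G$ and in the subgraph $\omega_p$. -/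

import Mathlib

open MeasureTheory ProbabilityTheory Filter Topology unitInterval

namespace DiestelLeader

/-! ### The 3-regular tree with its generation (horocyclic height) function -/

/-- A vertex of the 3-regular tree, seen from one of its ends. A vertex of height `n` is a finitely
supported binary sequence indexed by the integers `k ≥ n`, recorded as the finite set of the
indices that carry the digit `1`. -/
abbrev TreeVertex : Type := {v : ℤ × Finset ℤ // ∀ k ∈ v.2, v.1 ≤ k}

/-- The generation of a vertex, numbered backwards in time: parents are one higher. -/
def height (v : TreeVertex) : ℤ := v.1.1

/-- The parent of a vertex forgets the lowest digit. -/
def parent (v : TreeVertex) : TreeVertex :=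
  ⟨(v.1.1 + 1, v.1.2.erase v.1.1), fun k hk => by
    have h1 := Finset.ne_of_mem_erase hk
    have h2 := v.2 k (Finset.mem_of_mem_erase hk)
    simp only
    omega⟩

@[simp] lemma height_parent (v : TreeVertex) : height (parent v) = height v + 1 := rfl

/-- The tree: every vertex is joined to its parent. -/
def tree : SimpleGraph TreeVertex where
  Adj x y := y = parent x ∨ x = parent y
  symm := ⟨fun _ _ h => h.symm⟩
  loopless := ⟨fun x h => by
    have h' : x = parent x := h.elim id id
    have := congrArg height h'
    simp at this⟩

lemma tree_adj {x y : TreeVertex} : tree.Adj x y ↔ y = parent x ∨ x = parent y := Iff.rfl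

lemma height_iterate_parent (k : ℕ) (v : TreeVertex) :
    height (parent^[k] v) = height v + k := by
  induction k generalizing v with
  | zero => simp
  | succ k ih => rw [Function.iterate_succ_apply, ih]; simp; ring

lemma mem_digits_iterate_parent (k : ℕ) (v : TreeVertex) (j : ℤ) :
    j ∈ (parent^[k] v).1.2 ↔ j ∈ v.1.2 ∧ height v + k ≤ j := by
  induction k generalizing v with
  | zero => simpa [height] using fun h => v.2 j h
  | succ k ih =>
    rw [Function.iterate_succ_apply, ih]
    simp only [parent, Finset.mem_erase, height]
    push_cast
    constructor
    · rintro ⟨⟨h1, h2⟩, h3⟩; exact ⟨h2, by omega⟩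
    · rintro ⟨h1, h2⟩; exact ⟨⟨by omega, h1⟩, by omega⟩

lemma tree_reachable_iterate (k : ℕ) (v : TreeVertex) :
    tree.Reachable v (parent^[k] v) := by
  induction k generalizing v with
  | zero => exact SimpleGraph.Reachable.refl _
  | succ k ih =>
    rw [Function.iterate_succ_apply]
    exact (SimpleGraph.Adj.reachable (Or.inl rfl)).trans (ih _)

lemma exists_common_ancestor (v w : TreeVertex) :
    ∃ k l : ℕ, parent^[k] v = parent^[l] w := by
  obtain ⟨m, hm⟩ : ∃ m : ℤ, height v ≤ m ∧ height w ≤ m ∧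
      (∀ j ∈ v.1.2, j < m) ∧ ∀ j ∈ w.1.2, j < m := by
    obtain ⟨b, hb⟩ := (v.1.2 ∪ w.1.2).bddAbove
    refine ⟨max (b + 1) (max (height v) (height w)), by simp, by simp, ?_, ?_⟩ <;>
    · intro j hj
      have : j ≤ b := hb (by simp [hj])
      exact lt_of_lt_of_le (by omega) (le_max_left _ _)
  obtain ⟨h1, h2, h3, h4⟩ := hm
  refine ⟨(m - height v).toNat, (m - height w).toNat, Subtype.ext (Prod.ext ?_ ?_)⟩
  · have a := height_iterate_parent (m - height v).toNat v
    have b := height_iterate_parent (m - height w).toNat w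
    simp only [height] at a b h1 h2 ⊢
    omega
  · ext j
    rw [mem_digits_iterate_parent, mem_digits_iterate_parent]
    constructor
    · rintro ⟨a, b⟩
      have := h3 j a
      omega
    · rintro ⟨a, b⟩
      have := h4 j a
      omega

lemma tree_isBridge_parent (x : TreeVertex) : tree.IsBridge s(x, parent x) := by
  rw [SimpleGraph.isBridge_iff]
  intro h
  have key : ∀ y z, (tree.deleteEdges {s(x, parent x)}).Walk y z →
      (∃ k, parent^[k] y = x) → ∃ k, parent^[k] z = x := by
    intro y z w
    induction w with
    | nil => exact id
    | @cons a b c hab _ ih =>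
      rintro ⟨k, hk⟩
      refine ih ?_
      rw [SimpleGraph.deleteEdges_adj] at hab
      rcases hab with ⟨hab | hab, hne⟩
      · cases k with
        | zero =>
          simp only [Function.iterate_zero, id] at hk
          subst hk hab
          simp at hne
        | succ k => exact ⟨k, by rw [hab, ← Function.iterate_succ_apply]; exact hk⟩
      · exact ⟨k + 1, by rw [Function.iterate_succ_apply, ← hab]; exact hk⟩
  obtain ⟨w⟩ := h
  obtain ⟨k, hk⟩ := key _ _ w ⟨0, rfl⟩
  have := congrArg height hk
  rw [height_iterate_parent, height_parent] at this
  omega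

/-- The graph `tree` is indeed a tree. -/
theorem tree_isTree : tree.IsTree := by
  have : Nonempty TreeVertex := ⟨⟨(0, ∅), by simp⟩⟩
  refine ⟨SimpleGraph.Connected.mk fun v w => ?_, ?_⟩
  · obtain ⟨k, l, h⟩ := exists_common_ancestor v w
    exact (tree_reachable_iterate k v).trans (h ▸ (tree_reachable_iterate l w).symm)
  · rw [SimpleGraph.isAcyclic_iff_forall_isBridge]
    intro e
    induction e with
    | h x y =>
      intro he
      have he : y = parent x ∨ x = parent y := he
      rcases he with rfl | rfl
      · exact tree_isBridge_parent x
      · rw [Sym2.eq_swap]; exact tree_isBridge_parent y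

/-- Along every edge of the tree the height changes by one. -/
theorem height_of_adj {x y : TreeVertex} (h : tree.Adj x y) :
    height y = height x + 1 ∨ height y = height x - 1 := by
  rcases h with rfl | rfl <;> simp

/-- Every vertex has exactly one neighbour that is one higher. -/
theorem ncard_up (x : TreeVertex) : {y | tree.Adj x y ∧ height y = height x + 1}.ncard = 1 := by
  rw [Set.ncard_eq_one]
  refine ⟨parent x, Set.ext fun y => ⟨?_, ?_⟩⟩
  · rintro ⟨rfl | rfl, h⟩
    · rfl
    · simp only [height_parent] at h; omega
  · rintro rfl
    exact ⟨Or.inl rfl, rfl⟩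

/-- Every vertex has exactly two neighbours that are one lower. -/
theorem ncard_down (x : TreeVertex) : {y | tree.Adj x y ∧ height y = height x - 1}.ncard = 2 := by
  have hn : x.1.1 - 1 ∉ x.1.2 := fun h => by have := x.2 _ h; omega
  rw [Set.ncard_eq_two]
  refine ⟨⟨(x.1.1 - 1, x.1.2), fun k hk => by have := x.2 k hk; simp only; omega⟩,
    ⟨(x.1.1 - 1, insert (x.1.1 - 1) x.1.2), fun k hk => ?_⟩, ?_, ?_⟩
  · rcases Finset.mem_insert.1 hk with rfl | hk
    · exact le_rfl
    · have := x.2 k hk; simp only; omega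
  · intro h
    have h2 : x.1.2 = insert (x.1.1 - 1) x.1.2 := congrArg (fun v : TreeVertex => v.1.2) h
    exact hn (h2 ▸ Finset.mem_insert_self _ _)
  · ext y
    simp only [Set.mem_ofPred_eq, Set.mem_insert_iff, Set.mem_singleton_iff]
    constructor
    · rintro ⟨rfl | rfl, h⟩
      · simp only [height_parent] at h; omega
      · obtain ⟨⟨n, s⟩, hs⟩ := y
        by_cases hm : n ∈ s
        · right
          refine Subtype.ext (Prod.ext ?_ ?_) <;> simp [parent, Finset.insert_erase hm]
        · left
          refine Subtype.ext (Prod.ext ?_ ?_) <;> simp [parent, Finset.erase_eq_of_notMem hm]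
    · rintro (rfl | rfl)
      · refine ⟨Or.inr (Subtype.ext (Prod.ext ?_ ?_)), rfl⟩ <;>
          simp [parent, Finset.erase_eq_of_notMem hn]
      · refine ⟨Or.inr (Subtype.ext (Prod.ext ?_ ?_)), rfl⟩ <;>
          simp [parent, Finset.erase_insert hn]

/-! ### The Diestel–Leader graph -/

/-- The vertices of `DL(2,2)`: pairs of tree vertices of opposite heights. -/
abbrev DLVertex : Type := {v : TreeVertex × TreeVertex // height v.1 + height v.2 = 0}

/-- The Diestel–Leader graph `DL(2,2)`, the horocyclic product of two 3-regular trees. -/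
def DL : SimpleGraph DLVertex where
  Adj x y := tree.Adj x.1.1 y.1.1 ∧ tree.Adj x.1.2 y.1.2
  symm := ⟨fun _ _ h => ⟨h.1.symm, h.2.symm⟩⟩
  loopless := ⟨fun _ h => tree.loopless.irrefl _ h.1⟩

end DiestelLeader

namespace Percolation

/-! ### Geodesic cycles -/

section Cycles

variable {V : Type*}

/-- A closed walk is a geodesic cycle if it is a (simple) cycle and, for any two points of it, at
least one of the two arcs between them is a shortest path of `G`. -/
def IsGeodesicCycle (G : SimpleGraph V) {o : V} (w : G.Walk o o) : Prop :=
  w.IsCycle ∧ ∀ i j : ℕ, i ≤ j → j ≤ w.length →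
    G.dist (w.getVert i) (w.getVert j) = j - i ∨
    G.dist (w.getVert i) (w.getVert j) = w.length - (j - i)

/-- The geodesic cycles of `G` through the vertex `o`, each recorded as its set of edges. -/
def geodesicCycles (G : SimpleGraph V) (o : V) : Set (Set (Sym2 V)) :=
  {C | ∃ w : G.Walk o o, IsGeodesicCycle G w ∧ w.edgeSet = C}

end Cycles

/-! ### Configurations, Bernoulli percolation and the FK-Ising model -/

section Configurations

variable {V : Type*} (G : SimpleGraph V)

/-- Bond configurations on `G`: an edge is open when it has the value `true`. The space carries the
product topology and the product `σ`-algebra. -/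
abbrev Config : Type _ := G.edgeSet → Bool

/-- The spanning subgraph formed by the open edges of a configuration. -/
def openGraph (ω : Config G) : SimpleGraph V :=
  SimpleGraph.fromEdgeSet {e | ∃ h : e ∈ G.edgeSet, ω ⟨e, h⟩ = true}

/-- Bernoulli(`p`) bond percolation: the edges are open independently with probability `p`. -/
noncomputable def bernoulli (p : I) : Measure (Config G) :=
  Measure.infinitePi fun _ : G.edgeSet => bernoulliMeasure true false p

/-- The weight `p ^ #open * (1 - p) ^ #closed * 2 ^ #components` of a configuration on a finite
graph. For `p < 1` it is the constant `(1 - p) ^ #edges` times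
`(p / (1 - p)) ^ #open * 2 ^ #components`. -/
noncomputable def fkWeight (p : I) (η : Config G) : ℝ :=
  (p : ℝ) ^ Nat.card {e // η e = true} * (1 - (p : ℝ)) ^ Nat.card {e // η e = false} *
    2 ^ Nat.card (openGraph G η).ConnectedComponent

/-- The normalizing constant of the FK-Ising model on a finite graph. -/
noncomputable def fkPartition (p : I) : ℝ := ∑ᶠ η : Config G, fkWeight G p η

/-- The FK-Ising measure on a finite graph. -/
noncomputable def fkIsing (p : I) : Measure (Config G) :=
  Measure.sum fun η => ENNReal.ofReal (fkWeight G p η / fkPartition G p) • Measure.dirac η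

lemma fkWeight_nonneg (p : I) (η : Config G) : 0 ≤ fkWeight G p η := by
  have h0 := p.2.1
  have h1 := p.2.2
  have : 0 ≤ 1 - (p : ℝ) := by linarith
  unfold fkWeight
  positivity

lemma fkPartition_pos [Finite V] (p : I) : 0 < fkPartition G p := by
  have : Fintype (Config G) := Fintype.ofFinite _
  have h0 := p.2.1
  rw [fkPartition, finsum_eq_sum_of_fintype]
  refine Finset.sum_pos' (fun η _ => fkWeight_nonneg G p η) ?_
  rcases h0.eq_or_lt with hp | hp
  · refine ⟨fun _ => false, Finset.mem_univ _, ?_⟩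
    simp [fkWeight, ← hp]
  · refine ⟨fun _ => true, Finset.mem_univ _, ?_⟩
    simp only [fkWeight, Bool.true_eq_false, Nat.card_of_isEmpty, pow_zero, mul_one]
    positivity

instance fkIsing_isProbabilityMeasure [Finite V] (p : I) :
    IsProbabilityMeasure (fkIsing G p) := by
  have : Fintype (Config G) := Fintype.ofFinite _
  have hZ := fkPartition_pos G p
  refine ⟨?_⟩
  rw [fkIsing, Measure.sum_apply _ MeasurableSet.univ, tsum_fintype]
  simp only [Measure.smul_apply, measure_univ, smul_eq_mul, mul_one]
  rw [← ENNReal.ofReal_sum_of_nonneg fun η _ => div_nonneg (fkWeight_nonneg G p η) hZ.le,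
    ← Finset.sum_div, ← finsum_eq_sum_of_fintype, ← fkPartition, div_self hZ.ne',
    ENNReal.ofReal_one]

variable {G}

open Classical in
/-- A configuration on a subgraph `H` of `G`, extended to `G` by closed edges. -/
noncomputable def extendConfig (H : G.Subgraph) (η : Config H.coe) : Config G := fun e =>
  decide (∃ e' : H.coe.edgeSet, Sym2.map Subtype.val e'.1 = e.1 ∧ η e' = true)

/-- The FK-Ising measure of a finite subgraph `H` of `G`, as a law of configurations on `G` whose
open edges all lie in `H`. -/
noncomputable def fkIsingOn (H : G.Subgraph) [Finite H.verts] (p : I) :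
    ProbabilityMeasure (Config G) :=
  ⟨(fkIsing H.coe p).map (extendConfig H),
    Measure.isProbabilityMeasure_map (Measurable.of_discrete).aemeasurable⟩

variable (G)

/-- `μ` is the free FK-Ising measure on the countable graph `G`: for every increasing sequence of
finite subgraphs with union `G`, the FK-Ising measures of these subgraphs converge weakly
to `μ`. -/
def IsFreeFKIsing [Countable V] (p : I) (μ : ProbabilityMeasure (Config G)) : Prop :=
  ∀ (H : ℕ → G.Subgraph) [∀ n, Finite (H n).verts], Monotone H → ⨆ n, H n = ⊤ →
    Tendsto (fun n => fkIsingOn (H n) p) atTop (𝓝 μ)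

/-- The configurations `ω` that contain infinitely many geodesic cycles through `o`: cycles made of
open edges that are geodesic both in `G` and in the open subgraph. -/
def infinitelyManyGeodesicCycles (o : V) : Set (Config G) :=
  {ω | (geodesicCycles G o ∩ geodesicCycles (openGraph G ω) o).Infinite}

end Configurations

end Percolation

namespace Percolation

/-! ### The graphic rank of a set of edges -/

section Rank

/-! Geometry. Given `u` and `n ≥ 1`, choose `v` with the same second coordinate such that the first
coordinates of `u` and `v` first meet at their `n`-th ancestor (`Opposite n u v`). Going up in the
first tree while descending along digits `β` in the second, the paths from `u` and `v` run in
parallel and merge after `n` steps. Two digit sequences `β`, `β'` with different first digits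
therefore give a closed walk of length `4 * n`. A walk in `DL` between antipodal points must rise in
the first tree to the common ancestor, to change the first coordinate. It must also return to the
height of `u`, to change the first digit written in the second tree. Together these cost `2 * n`
steps (`Opposite.two_mul_le_length`). So the closed walk is a geodesic cycle of `DL`, and of every
subgraph that contains it.

Bernoulli percolation. A pair of parallel paths branches in two at each step, and each branch needs
two open edges. Subtrees of the second tree involve disjoint sets of edges, so this is a binary
branching process with mean offspring `2 * p ^ 2`. When `p > 1 / √2`, the pair reaches depth `n`
with probability at least `2 * p ^ 2 - 1` (`le_bernoulli_linked`). Both first digits succeed with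
probability bounded below uniformly in `n`, and a reverse Fatou argument gives infinitely many `n`
with positive probability.

FK-Ising. Writing `2 ^ k` as a constant times `(1 / 2) ^ rank` and using submodularity of the
graphic rank, the Holley criterion shows that the finite measures increase with the subgraph and
dominate Bernoulli percolation of parameter `p / (2 - p)`. Monotonicity and compactness give the
free measure; the domination passes to the limit on increasing cylinder events such as the cycle
events. -/

/-- The number of components plus the dimension of the space spanned by the differences along
edges is the number of vertices. -/
lemma card_connectedComponent_add_finrank {X : Type*} [Finite X] (Γ : SimpleGraph X) :
    Nat.card Γ.ConnectedComponent + Module.finrank ℚ (Submodule.span ℚ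
      {f : X →₀ ℚ | ∃ u v, Γ.Adj u v ∧ f = Finsupp.single u 1 - Finsupp.single v 1})
      = Nat.card X := by
  classical
  have : Fintype X := Fintype.ofFinite X
  have : Fintype Γ.ConnectedComponent := Fintype.ofFinite _
  -- The map `q` adds up the coefficients over each component. Once its kernel is identified with
  -- the span, rank-nullity gives the count.
  set q : (X →₀ ℚ) →ₗ[ℚ] (Γ.ConnectedComponent →₀ ℚ) :=
    Finsupp.lmapDomain ℚ ℚ Γ.connectedComponentMk with hq
  have hsurj : Function.Surjective q :=
    Finsupp.mapDomain_surjective (fun c => Quot.exists_rep c)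
  have hker : LinearMap.ker q = Submodule.span ℚ
      {f : X →₀ ℚ | ∃ u v, Γ.Adj u v ∧ f = Finsupp.single u 1 - Finsupp.single v 1} := by
    apply le_antisymm
    · set N := Submodule.span ℚ
        {f : X →₀ ℚ | ∃ u v, Γ.Adj u v ∧ f = Finsupp.single u 1 - Finsupp.single v 1} with hN
      have hreach : ∀ u v, Γ.Reachable u v →
          (Finsupp.single u 1 - Finsupp.single v 1 : X →₀ ℚ) ∈ N := by
        rintro u v ⟨w⟩
        induction w with
        | nil => simp
        | @cons a b c hab _ ih =>
          have h1 : (Finsupp.single a 1 - Finsupp.single b 1 : X →₀ ℚ) ∈ N :=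
            Submodule.subset_span ⟨a, b, hab, rfl⟩
          simpa using N.add_mem h1 ih
      -- With one representative per component, moving all the mass of `f` to the representatives
      -- changes `f` by an element of `N` only; if `q f = 0`, nothing is left.
      choose s hs using fun c : Γ.ConnectedComponent => Quot.exists_rep c
      have hdec : ∀ f : X →₀ ℚ, f - Finsupp.lmapDomain ℚ ℚ s (q f) ∈ N := by
        intro f
        induction f using Finsupp.induction_linear with
        | zero => simp
        | add f g hf hg =>
          have := N.add_mem hf hg
          rw [map_add, map_add]
          convert this using 1
          abel
        | single x a =>
          have h1 : Γ.Reachable x (s (Γ.connectedComponentMk x)) :=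
            (SimpleGraph.ConnectedComponent.exact (hs (Γ.connectedComponentMk x))).symm
          have h2 := N.smul_mem a (hreach _ _ h1)
          simpa [hq, Finsupp.mapDomain_single, smul_sub] using h2
      intro f hf
      have := hdec f
      rw [LinearMap.mem_ker] at hf
      simpa [hf] using this
    · rw [Submodule.span_le]
      rintro _ ⟨u, v, huv, rfl⟩
      have : Γ.connectedComponentMk u = Γ.connectedComponentMk v :=
        SimpleGraph.ConnectedComponent.sound huv.reachable
      rw [SetLike.mem_coe, LinearMap.mem_ker, map_sub]
      simp [hq, Finsupp.mapDomain_single, this]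
  have := q.finrank_range_add_finrank_ker
  rw [LinearMap.range_eq_top.2 hsurj, finrank_top, hker] at this
  simpa using this

variable {V : Type*} {G : SimpleGraph V}

/-- The difference of the indicators of the two ends of an edge. -/
noncomputable def edgeVec (e : Sym2 V) : V →₀ ℚ :=
  Finsupp.single e.out.1 1 - Finsupp.single e.out.2 1

/-- `Sym2.out` picks an uncontrolled orientation; spans do not see the sign. -/
lemma edgeVec_mk (u v : V) :
    edgeVec s(u, v) = Finsupp.single u 1 - Finsupp.single v 1 ∨
    edgeVec s(u, v) = -(Finsupp.single u 1 - Finsupp.single v 1) := by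
  have h : s((s(u, v)).out.1, (s(u, v)).out.2) = s(u, v) := Quot.out_eq _
  rw [Sym2.eq_iff] at h
  rcases h with ⟨h1, h2⟩ | ⟨h1, h2⟩
  · left; rw [edgeVec, h1, h2]
  · right; rw [edgeVec, h1, h2]; abel

/-- The span of the edge vectors of a set of edges. -/
noncomputable def edgeSpan (S : Finset G.edgeSet) : Submodule ℚ (V →₀ ℚ) :=
  Submodule.span ℚ ((fun e : G.edgeSet => edgeVec e.1) '' S)

/-- The rank of a set of edges in the graphic matroid. -/
noncomputable def edgeRank (S : Finset G.edgeSet) : ℕ := Module.finrank ℚ (edgeSpan S)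

instance (S : Finset G.edgeSet) : FiniteDimensional ℚ (edgeSpan S) :=
  FiniteDimensional.span_of_finite ℚ (S.finite_toSet.image _)

lemma edgeSpan_union [DecidableEq G.edgeSet] (S T : Finset G.edgeSet) : edgeSpan (S ∪ T) = edgeSpan S ⊔ edgeSpan T := by
  simp [edgeSpan, Set.image_union, Submodule.span_union]

lemma edgeSpan_mono {S T : Finset G.edgeSet} (h : S ⊆ T) : edgeSpan S ≤ edgeSpan T :=
  Submodule.span_mono (Set.image_mono (by exact_mod_cast h))

/-- Dimension is modular on subspaces, and the span of an intersection lies in the intersection of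
the spans, possibly strictly. -/
lemma edgeRank_submodular [DecidableEq G.edgeSet] (S T : Finset G.edgeSet) :
    edgeRank (S ∪ T) + edgeRank (S ∩ T) ≤ edgeRank S + edgeRank T := by
  have h := Submodule.finrank_sup_add_finrank_inf_eq (edgeSpan S) (edgeSpan T)
  have h2 : Module.finrank ℚ (edgeSpan (S ∩ T)) ≤
      Module.finrank ℚ (edgeSpan S ⊓ edgeSpan T : Submodule ℚ (V →₀ ℚ)) :=
    Submodule.finrank_mono (le_inf (edgeSpan_mono Finset.inter_subset_left)
      (edgeSpan_mono Finset.inter_subset_right))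
  rw [← edgeSpan_union] at h
  unfold edgeRank
  omega

lemma edgeRank_le_card (S : Finset G.edgeSet) : edgeRank S ≤ S.card := by
  classical
  rw [edgeRank, edgeSpan, ← Finset.coe_image]
  exact (finrank_span_finset_le_card _).trans Finset.card_image_le

lemma edgeRank_union_le [DecidableEq G.edgeSet] (S T : Finset G.edgeSet) :
    edgeRank (S ∪ T) ≤ edgeRank T + (S \ T).card := by
  have h : S ∪ T = (S \ T) ∪ T := by simp
  have := edgeRank_submodular (S \ T) T
  have := edgeRank_le_card (S \ T)
  rw [h]
  omega

end Rank

/-! ### Finite subgraphs and their configurations -/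

section Subgraphs

variable {V : Type*} {G : SimpleGraph V}

/-- The inclusion of the edges of a subgraph. -/
def edgeInclusion (H : G.Subgraph) : H.coe.edgeSet ↪ G.edgeSet where
  toFun e := ⟨Sym2.map Subtype.val e.1, by
    obtain ⟨e, he⟩ := e
    induction e with
    | h u v => exact H.adj_sub he⟩
  inj' e f h := Subtype.ext (Sym2.map.injective Subtype.val_injective (congrArg Subtype.val h))

/-- The edges of a finite subgraph. -/
noncomputable def edgesOf (H : G.Subgraph) [Finite H.verts] : Finset G.edgeSet :=
  (Set.toFinite (Set.range (edgeInclusion H))).toFinset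

lemma mem_edgesOf {H : G.Subgraph} [Finite H.verts] {e : G.edgeSet} :
    e ∈ edgesOf H ↔ e.1 ∈ H.edgeSet := by
  rw [edgesOf, Set.Finite.mem_toFinset]
  obtain ⟨e, he⟩ := e
  induction e with
  | h u v =>
    constructor
    · rintro ⟨⟨f, hf⟩, h⟩
      have h : Sym2.map Subtype.val f = s(u, v) := congrArg Subtype.val h
      induction f with
      | h a b =>
        change s(u, v) ∈ H.edgeSet
        rw [← h]
        exact hf
    · intro h
      have h : H.Adj u v := h
      exact ⟨⟨s(⟨u, H.edge_vert h⟩, ⟨v, H.edge_vert h.symm⟩), h⟩, rfl⟩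

/-- The open edges of a configuration on a finite subgraph. -/
noncomputable def openEdges {H : G.Subgraph} [Finite H.verts] (η : Config H.coe) :
    Finset G.edgeSet :=
  (Set.toFinite (edgeInclusion H '' {e | η e = true})).toFinset

open Classical in
/-- The configuration in which exactly the edges of `S` are open. -/
noncomputable def ofEdges (S : Finset G.edgeSet) : Config G := fun e => decide (e ∈ S)

lemma coe_openEdges {H : G.Subgraph} [Finite H.verts] (η : Config H.coe) :
    (openEdges η : Set G.edgeSet) = edgeInclusion H '' {e | η e = true} := by
  simp [openEdges]

lemma extendConfig_eq {H : G.Subgraph} [Finite H.verts] (η : Config H.coe) :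
    extendConfig H η = ofEdges (openEdges η) := by
  funext e
  unfold extendConfig ofEdges
  rw [decide_eq_decide, openEdges, Set.Finite.mem_toFinset]
  refine exists_congr fun f => ?_
  rw [and_comm, Subtype.ext_iff]
  rfl

lemma mem_openEdges_inclusion {H : G.Subgraph} [Finite H.verts] {η : Config H.coe}
    {e : H.coe.edgeSet} : edgeInclusion H e ∈ openEdges η ↔ η e = true := by
  rw [← Finset.mem_coe, coe_openEdges, (edgeInclusion H).injective.mem_set_image]
  rfl

lemma openEdges_subset {H : G.Subgraph} [Finite H.verts] (η : Config H.coe) :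
    openEdges η ⊆ edgesOf H := by
  intro e he
  rw [← Finset.mem_coe, coe_openEdges] at he
  obtain ⟨f, -, rfl⟩ := he
  simp [edgesOf]

lemma card_openEdges {H : G.Subgraph} [Finite H.verts] (η : Config H.coe) :
    Nat.card {e // η e = true} = (openEdges η).card := by
  rw [← Set.ncard_coe_finset, coe_openEdges, Set.ncard_image_of_injective _
    (edgeInclusion H).injective]
  rfl

lemma card_closedEdges [DecidableEq G.edgeSet] {H : G.Subgraph} [Finite H.verts]
    (η : Config H.coe) :
    Nat.card {e // η e = false} = (edgesOf H \ openEdges η).card := by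
  have : ((edgesOf H \ openEdges η : Finset G.edgeSet) : Set G.edgeSet) =
      edgeInclusion H '' {e | η e = false} := by
    ext e
    constructor
    · intro he
      rw [Finset.mem_coe, Finset.mem_sdiff] at he
      obtain ⟨h1, h2⟩ := he
      obtain ⟨f, rfl⟩ : e ∈ Set.range (edgeInclusion H) := by simpa [edgesOf] using h1
      exact ⟨f, by simpa [mem_openEdges_inclusion] using h2, rfl⟩
    · rintro ⟨f, hf, rfl⟩
      rw [Finset.mem_coe, Finset.mem_sdiff, mem_openEdges_inclusion]
      have : η f = false := hf
      simp [edgesOf, this]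
  rw [← Set.ncard_coe_finset, this, Set.ncard_image_of_injective _ (edgeInclusion H).injective]
  rfl

/-- Sums over configurations of different subgraphs become sums over subsets of the one set
`G.edgeSet`, where they can be compared. -/
lemma openEdges_bijective (H : G.Subgraph) [Finite H.verts] :
    Set.BijOn (openEdges (H := H)) Set.univ {S | S ⊆ edgesOf H} := by
  classical
  refine ⟨fun η _ => openEdges_subset η, fun η _ η' _ h => ?_, fun S hS => ?_⟩
  · funext e
    have := congrArg (edgeInclusion H e ∈ ·) h
    simp only [mem_openEdges_inclusion, eq_iff_iff] at this
    rwa [Bool.eq_iff_iff]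
  · refine ⟨fun e => decide (edgeInclusion H e ∈ S), trivial, ?_⟩
    ext e
    constructor
    · intro he
      rw [← Finset.mem_coe, coe_openEdges] at he
      obtain ⟨f, hf, rfl⟩ := he
      simpa using hf
    · intro he
      obtain ⟨f, rfl⟩ : e ∈ Set.range (edgeInclusion H) := by simpa [edgesOf] using hS he
      rw [mem_openEdges_inclusion]
      simpa using he

lemma openGraph_adj {V : Type*} {G : SimpleGraph V} {ω : Config G} {u v : V} :
    (openGraph G ω).Adj u v ↔ ∃ h : G.Adj u v, ω ⟨s(u, v), h⟩ = true := by
  rw [openGraph, SimpleGraph.fromEdgeSet_adj]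
  exact ⟨fun h => h.1, fun h => ⟨h, h.1.ne⟩⟩

/-- Extending by zero embeds the vertex space of `H` into that of `G`, so the rank may be computed
in `G`, independently of `H`. -/
lemma card_connectedComponent_openGraph {H : G.Subgraph} [Finite H.verts] (η : Config H.coe) :
    Nat.card (openGraph H.coe η).ConnectedComponent + edgeRank (openEdges η) =
      Nat.card H.verts := by
  rw [← card_connectedComponent_add_finrank (openGraph H.coe η)]
  congr 1
  have hinj : Function.Injective (Finsupp.lmapDomain ℚ ℚ (Subtype.val : H.verts → V)) :=
    Finsupp.mapDomain_injective Subtype.val_injective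
  rw [(Submodule.equivMapOfInjective _ hinj _).finrank_eq, edgeRank, Submodule.map_span]
  suffices h : edgeSpan (openEdges η) = Submodule.span ℚ
      (Finsupp.lmapDomain ℚ ℚ (Subtype.val : H.verts → V) ''
        {f | ∃ u v, (openGraph H.coe η).Adj u v ∧
          f = Finsupp.single u 1 - Finsupp.single v 1}) by rw [h]
  apply le_antisymm
  · rw [edgeSpan, Submodule.span_le, coe_openEdges]
    rintro _ ⟨_, ⟨⟨f, hf⟩, hη, rfl⟩, rfl⟩
    induction f with
    | h u v =>
      have hmem : (Finsupp.single u.1 1 - Finsupp.single v.1 1 : V →₀ ℚ) ∈ Submodule.span ℚ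
          (Finsupp.lmapDomain ℚ ℚ (Subtype.val : H.verts → V) ''
          {f | ∃ u v, (openGraph H.coe η).Adj u v ∧
            f = Finsupp.single u 1 - Finsupp.single v 1}) := by
        refine Submodule.subset_span ⟨Finsupp.single u 1 - Finsupp.single v 1,
          ⟨u, v, openGraph_adj.2 ⟨hf, hη⟩, rfl⟩, ?_⟩
        rw [map_sub]
        simp [Finsupp.mapDomain_single]
      change edgeVec s(u.1, v.1) ∈ _
      rcases edgeVec_mk u.1 v.1 with h | h
      · rw [h]
        exact hmem
      · rw [h]
        exact Submodule.neg_mem _ hmem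
  · rw [Submodule.span_le]
    rintro _ ⟨_, ⟨u, v, huv, rfl⟩, rfl⟩
    obtain ⟨hadj, hη⟩ := openGraph_adj.1 huv
    have hmem : edgeVec s(u.1, v.1) ∈ edgeSpan (openEdges η) := by
      refine Submodule.subset_span ⟨edgeInclusion H ⟨s(u, v), hadj⟩, ?_, rfl⟩
      rw [Finset.mem_coe, mem_openEdges_inclusion]
      exact hη
    rw [SetLike.mem_coe, map_sub]
    simp only [Finsupp.lmapDomain_apply, Finsupp.mapDomain_single]
    rcases edgeVec_mk u.1 v.1 with h | h
    · exact h ▸ hmem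
    · rw [h] at hmem
      simpa using Submodule.neg_mem _ hmem

end Subgraphs

end Percolation

namespace Percolation

/-! ### Stochastic comparison of finite models -/

section Holley

open scoped FinsetFamily

/-- The Holley inequality for two weights on the subsets of nested finite sets. -/
lemma holley_powerset {α : Type*} [DecidableEq α] {E E' : Finset α} (hE : E ⊆ E')
    {w w' f : Finset α → ℝ} (hw : 0 ≤ w) (hw' : 0 ≤ w') (hf : 0 ≤ f) (hmono : Monotone f)
    (h : ∀ s ⊆ E, ∀ t ⊆ E', w s * w' t ≤ w (s ∩ t) * w' (s ∪ t)) :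
    (∑ s ∈ E.powerset, w s * f s) * ∑ s ∈ E'.powerset, w' s ≤
      (∑ s ∈ E.powerset, w s) * ∑ s ∈ E'.powerset, w' s * f s := by
  -- The criterion is available only for `s ⊆ E`, so the first function is cut off outside `E`; the
  -- increasing `f` is moved from `s` to `s ∪ t`.
  have key := E'.four_functions_theorem (f₁ := fun s => if s ⊆ E then w s * f s else 0)
    (f₂ := w') (f₃ := w) (f₄ := fun s => w' s * f s)
    (fun s => by
      beta_reduce
      split_ifs
      · exact mul_nonneg (hw s) (hf s)
      · exact le_rfl)
    hw' hw (fun s => mul_nonneg (hw' s) (hf s))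
    (fun s _ t ht => by
      split_ifs with hs
      · calc w s * f s * w' t = (w s * w' t) * f s := by ring
          _ ≤ (w (s ∩ t) * w' (s ∪ t)) * f (s ∪ t) :=
            mul_le_mul (h s hs t ht) (hmono Finset.subset_union_left) (hf s)
              (mul_nonneg (hw _) (hw' _))
          _ = _ := by ring
      · rw [zero_mul]
        exact mul_nonneg (hw _) (mul_nonneg (hw' _) (hf _)))
    (Finset.powerset_mono.2 hE) (le_refl E'.powerset)
  rw [← Finset.powerset_inter, ← Finset.powerset_union, Finset.inter_eq_left.2 hE,
    Finset.union_eq_right.2 hE] at key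
  rwa [Finset.sum_congr rfl fun s hs => if_pos (Finset.mem_powerset.1 hs)] at key

end Holley

/-! ### Edge weights and the Holley criterion -/

section Weights

variable {V : Type*} {G : SimpleGraph V}

open Classical in
/-- The Bernoulli weight of a subset `S` of a finite set `E` of edges. -/
noncomputable def bernoulliWeight (p : ℝ) (E S : Finset G.edgeSet) : ℝ :=
  p ^ S.card * (1 - p) ^ (E \ S).card

/-- The FK-Ising weight of a subset `S` of a finite set `E` of edges, up to a factor that only
depends on the number of vertices. -/
noncomputable def rankWeight (p : ℝ) (E S : Finset G.edgeSet) : ℝ :=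
  bernoulliWeight p E S * (1 / 2) ^ edgeRank S

lemma bernoulliWeight_eq [DecidableEq G.edgeSet] (p : ℝ) (E S : Finset G.edgeSet) :
    bernoulliWeight p E S = p ^ S.card * (1 - p) ^ (E \ S).card := by
  unfold bernoulliWeight
  congr!

lemma bernoulliWeight_nonneg {p : ℝ} (hp : p ∈ I) (E : Finset G.edgeSet) :
    0 ≤ bernoulliWeight p E := by
  intro S
  have h0 := hp.1
  have : 0 ≤ 1 - p := by linarith [hp.2]
  unfold bernoulliWeight
  positivity

lemma rankWeight_nonneg {p : ℝ} (hp : p ∈ I) (E : Finset G.edgeSet) : 0 ≤ rankWeight p E :=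
  fun S => mul_nonneg (bernoulliWeight_nonneg hp E S) (by positivity)

lemma sum_bernoulliWeight (p : ℝ) (E : Finset G.edgeSet) :
    ∑ S ∈ E.powerset, bernoulliWeight p E S = 1 := by
  classical
  have := Finset.prod_add (fun _ : G.edgeSet => p) (fun _ => 1 - p) E
  simp only [Finset.prod_const, add_sub_cancel, one_pow] at this
  rw [this]
  exact Finset.sum_congr rfl fun S _ => bernoulliWeight_eq p E S

/-- The rank is at most the number of edges, so the sum is at least `(1 / 2) ^ E.card` times the
total Bernoulli mass `1`. -/
lemma sum_rankWeight_pos {p : ℝ} (hp : p ∈ I) (E : Finset G.edgeSet) :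
    0 < ∑ S ∈ E.powerset, rankWeight p E S := by
  have h : ∑ S ∈ E.powerset, bernoulliWeight p E S * (1 / 2) ^ E.card ≤
      ∑ S ∈ E.powerset, rankWeight p E S := by
    refine Finset.sum_le_sum fun S hS => ?_
    refine mul_le_mul_of_nonneg_left ?_ (bernoulliWeight_nonneg hp E S)
    exact pow_le_pow_of_le_one (by norm_num) (by norm_num)
      ((edgeRank_le_card S).trans (Finset.card_le_card (Finset.mem_powerset.1 hS)))
  rw [← Finset.sum_mul, sum_bernoulliWeight] at h
  exact lt_of_lt_of_le (by positivity) h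

/-- All exponents in the Holley criteria shift by the same amount `(s \ t).card`. -/
lemma card_identities [DecidableEq G.edgeSet] {E E' s t : Finset G.edgeSet} (hE : E ⊆ E')
    (hs : s ⊆ E) (ht : t ⊆ E') :
    s.card = (s ∩ t).card + (s \ t).card ∧ (s ∪ t).card = t.card + (s \ t).card ∧
    (E \ (s ∩ t)).card = (E \ s).card + (s \ t).card ∧
    (E' \ t).card = (E' \ (s ∪ t)).card + (s \ t).card := by
  have h1 := Finset.card_sdiff_of_subset hs
  have h2 := Finset.card_sdiff_of_subset ht
  have h3 := Finset.card_sdiff_of_subset (Finset.inter_subset_left.trans hs : s ∩ t ⊆ E)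
  have h4 := Finset.card_sdiff_of_subset (Finset.union_subset (hs.trans hE) ht : s ∪ t ⊆ E')
  have h5 := Finset.card_inter_add_card_sdiff s t
  have h6 := Finset.card_union_add_card_inter s t
  have h7 := Finset.card_le_card hs
  have h8 := Finset.card_le_card ht
  have h9 := Finset.card_le_card (Finset.union_subset (hs.trans hE) ht : s ∪ t ⊆ E')
  omega

/-- FK-Ising weights of nested sets of edges satisfy the Holley criterion. -/
lemma rankWeight_holley [DecidableEq G.edgeSet] {p : ℝ} (hp : p ∈ I) {E E' : Finset G.edgeSet}
    (hE : E ⊆ E') (s : Finset G.edgeSet) (hs : s ⊆ E) (t : Finset G.edgeSet) (ht : t ⊆ E') :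
    rankWeight p E s * rankWeight p E' t ≤ rankWeight p E (s ∩ t) * rankWeight p E' (s ∪ t) := by
  obtain ⟨h1, h2, h3, h4⟩ := card_identities hE hs ht
  have hr := edgeRank_submodular s t
  have hq : 0 ≤ 1 - p := by linarith [hp.2]
  have h0 := hp.1
  -- The Bernoulli factors of the two sides are equal; the whole inequality is submodularity of the
  -- rank, reversed because the base is below one.
  have key : ((1 : ℝ) / 2) ^ (edgeRank s + edgeRank t) ≤
      (1 / 2) ^ (edgeRank (s ∩ t) + edgeRank (s ∪ t)) :=
    pow_le_pow_of_le_one (by norm_num) (by norm_num) (by omega)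
  calc _ = p ^ ((s ∩ t).card + (s ∪ t).card) * (1 - p) ^ ((E \ (s ∩ t)).card +
        (E' \ (s ∪ t)).card) * (1 / 2) ^ (edgeRank s + edgeRank t) := by
        rw [show (s ∩ t).card + (s ∪ t).card = s.card + t.card by omega,
          show (E \ (s ∩ t)).card + (E' \ (s ∪ t)).card = (E \ s).card + (E' \ t).card by omega,
          rankWeight, rankWeight, bernoulliWeight_eq, bernoulliWeight_eq]
        ring
    _ ≤ p ^ ((s ∩ t).card + (s ∪ t).card) * (1 - p) ^ ((E \ (s ∩ t)).card +
        (E' \ (s ∪ t)).card) * (1 / 2) ^ (edgeRank (s ∩ t) + edgeRank (s ∪ t)) := by gcongr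
    _ = _ := by
        rw [rankWeight, rankWeight, bernoulliWeight_eq, bernoulliWeight_eq]
        ring

/-- The FK-Ising weight dominates the Bernoulli weight of parameter `p / (2 - p)`. -/
lemma bernoulliWeight_holley [DecidableEq G.edgeSet] {p : ℝ} (hp : p ∈ I)
    (E : Finset G.edgeSet) (s : Finset G.edgeSet) (hs : s ⊆ E) (t : Finset G.edgeSet)
    (ht : t ⊆ E) :
    bernoulliWeight (p / (2 - p)) E s * rankWeight p E t ≤
      bernoulliWeight (p / (2 - p)) E (s ∩ t) * rankWeight p E (s ∪ t) := by
  obtain ⟨h1, h2, h3, h4⟩ := card_identities (le_refl E) hs ht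
  have hr := edgeRank_union_le s t
  have h0 := hp.1
  have hq : 0 ≤ 1 - p := by linarith [hp.2]
  have hq2 : 0 < 2 - p := by linarith [hp.2]
  have hx : 0 ≤ p / (2 - p) := by positivity
  have hy : 0 ≤ 1 - p / (2 - p) := by
    rw [sub_nonneg, div_le_one hq2]
    linarith
  -- This balance determines the parameter `p / (2 - p)`: its odds are half those of `p`, the worst
  -- case in which an added edge merges two components.
  have hbal : p / (2 - p) * (1 - p) = (1 - p / (2 - p)) * p * (1 / 2) := by
    field_simp
    ring
  have key : ((1 : ℝ) / 2) ^ (edgeRank t + (s \ t).card) ≤ (1 / 2) ^ edgeRank (s ∪ t) :=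
    pow_le_pow_of_le_one (by norm_num) (by norm_num) hr
  simp only [rankWeight, bernoulliWeight_eq]
  set x := p / (2 - p)
  have h3' : (E \ (s ∩ t)).card = (E \ s).card + (s \ t).card := h3
  calc _ = x ^ (s ∩ t).card * (1 - x) ^ (E \ s).card * p ^ t.card * (1 - p) ^ (E \ (s ∪ t)).card *
        (1 / 2) ^ edgeRank t * (x * (1 - p)) ^ (s \ t).card := by
        rw [mul_pow, h1, pow_add]
        have : (1 - p) ^ (E \ t).card =
          (1 - p) ^ (E \ (s ∪ t)).card * (1 - p) ^ (s \ t).card := by rw [h4, pow_add]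
        rw [this]
        ring
    _ = x ^ (s ∩ t).card * (1 - x) ^ (E \ (s ∩ t)).card * (p ^ (s ∪ t).card *
        (1 - p) ^ (E \ (s ∪ t)).card * (1 / 2) ^ (edgeRank t + (s \ t).card)) := by
        rw [hbal, mul_pow, mul_pow, h3', h2]
        ring
    _ ≤ x ^ (s ∩ t).card * (1 - x) ^ (E \ (s ∩ t)).card * (p ^ (s ∪ t).card *
        (1 - p) ^ (E \ (s ∪ t)).card * (1 / 2) ^ edgeRank (s ∪ t)) := by gcongr

lemma sum_rankWeight_mono {p : ℝ} (hp : p ∈ I) {E E' : Finset G.edgeSet} (hE : E ⊆ E')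
    {f : Finset G.edgeSet → ℝ} (hf : 0 ≤ f) (hmono : Monotone f) :
    (∑ S ∈ E.powerset, rankWeight p E S * f S) / ∑ S ∈ E.powerset, rankWeight p E S ≤
    (∑ S ∈ E'.powerset, rankWeight p E' S * f S) / ∑ S ∈ E'.powerset, rankWeight p E' S := by
  classical
  rw [div_le_div_iff₀ (sum_rankWeight_pos hp E) (sum_rankWeight_pos hp E')]
  have := holley_powerset hE (rankWeight_nonneg hp E) (rankWeight_nonneg hp E') hf hmono
    (rankWeight_holley hp hE)
  linarith

lemma div_two_sub_mem {p : ℝ} (hp : p ∈ I) : p / (2 - p) ∈ I := by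
  have h0 := hp.1
  have h1 := hp.2
  have h2 : 0 < 2 - p := by linarith
  exact ⟨by positivity, by rw [div_le_one h2]; linarith⟩

lemma sum_bernoulliWeight_le {p : ℝ} (hp : p ∈ I) (E : Finset G.edgeSet)
    {f : Finset G.edgeSet → ℝ} (hf : 0 ≤ f) (hmono : Monotone f) :
    ∑ S ∈ E.powerset, bernoulliWeight (p / (2 - p)) E S * f S ≤
    (∑ S ∈ E.powerset, rankWeight p E S * f S) / ∑ S ∈ E.powerset, rankWeight p E S := by
  classical
  rw [le_div_iff₀ (sum_rankWeight_pos hp E)]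
  have := holley_powerset (le_refl E) (bernoulliWeight_nonneg (div_two_sub_mem hp) E)
    (rankWeight_nonneg hp E) hf hmono (bernoulliWeight_holley hp E)
  rwa [sum_bernoulliWeight, one_mul] at this

end Weights

/-! ### Stochastic domination for the finite measures -/

section FiniteMeasures

variable {V : Type*} {G : SimpleGraph V}

/-- The prefactor does not depend on the configuration and cancels on normalization. -/
lemma fkWeight_eq_rankWeight {H : G.Subgraph} [Finite H.verts] (p : I) (η : Config H.coe) :
    fkWeight H.coe p η = 2 ^ Nat.card H.verts * rankWeight p (edgesOf H) (openEdges η) := by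
  classical
  rw [fkWeight, ← card_connectedComponent_openGraph η, card_openEdges, card_closedEdges,
    rankWeight, bernoulliWeight_eq, pow_add]
  rw [show ∀ a b c d : ℝ, c * d * (a * b * (1 / 2) ^ edgeRank (openEdges η)) =
    a * b * c * (d * (1 / 2) ^ edgeRank (openEdges η)) by intros; ring, ← mul_pow]
  norm_num

lemma sum_fkWeight {H : G.Subgraph} [Finite H.verts] [Fintype (Config H.coe)] (p : I)
    (f : Finset G.edgeSet → ℝ) :
    ∑ η : Config H.coe, fkWeight H.coe p η * f (openEdges η) =
      2 ^ Nat.card H.verts * ∑ S ∈ (edgesOf H).powerset, rankWeight p (edgesOf H) S * f S := by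
  have hb := openEdges_bijective H
  rw [Finset.mul_sum]
  refine Finset.sum_nbij openEdges (fun η _ => Finset.mem_powerset.2 (openEdges_subset η))
    (by simpa using hb.injOn) ?_ (fun η _ => by rw [fkWeight_eq_rankWeight]; ring)
  intro S hS
  obtain ⟨η, -, hη⟩ := hb.surjOn (Finset.mem_powerset.1 (Finset.mem_coe.1 hS))
  exact ⟨η, by simp, hη⟩

open Classical in
/-- The probability of an event under the FK-Ising measure of a finite subgraph, as a sum over
sets of edges. -/
lemma fkIsingOn_real (H : G.Subgraph) [Finite H.verts] (p : I) {A : Set (Config G)}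
    (hA : MeasurableSet A) :
    (fkIsingOn H p : Measure (Config G)).real A =
      (∑ S ∈ (edgesOf H).powerset, rankWeight p (edgesOf H) S *
        (if ofEdges S ∈ A then 1 else 0)) /
      ∑ S ∈ (edgesOf H).powerset, rankWeight p (edgesOf H) S := by
  have : Fintype (Config H.coe) := Fintype.ofFinite _
  have hZ : fkPartition H.coe p = 2 ^ Nat.card H.verts *
      ∑ S ∈ (edgesOf H).powerset, rankWeight p (edgesOf H) S := by
    rw [fkPartition, finsum_eq_sum_of_fintype]
    simpa using sum_fkWeight (H := H) p (fun _ => 1)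
  have h1 : (fkIsingOn H p : Measure (Config G)) A =
      ENNReal.ofReal ((∑ η : Config H.coe, fkWeight H.coe p η *
        (if ofEdges (openEdges η) ∈ A then 1 else 0)) / fkPartition H.coe p) := by
    change (Measure.map (extendConfig H) (fkIsing H.coe p)) A = _
    rw [Measure.map_apply Measurable.of_discrete hA, fkIsing,
      Measure.sum_apply _ (MeasurableSet.of_discrete), tsum_fintype, Finset.sum_div,
      ENNReal.ofReal_sum_of_nonneg]
    · refine Finset.sum_congr rfl fun η _ => ?_
      rw [Measure.smul_apply, Measure.dirac_apply' _ (MeasurableSet.of_discrete)]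
      by_cases h : ofEdges (openEdges η) ∈ A <;>
        simp [Set.indicator, extendConfig_eq, h]
    · intro η _
      refine div_nonneg (mul_nonneg (fkWeight_nonneg _ _ _) ?_) (fkPartition_pos _ _).le
      split_ifs <;> norm_num
  rw [measureReal_def, h1, ENNReal.toReal_ofReal,
    sum_fkWeight p (fun S => if ofEdges S ∈ A then 1 else 0), hZ,
    mul_div_mul_left _ _ (by positivity)]
  refine div_nonneg (Finset.sum_nonneg fun η _ => mul_nonneg (fkWeight_nonneg _ _ _) ?_)
    (fkPartition_pos _ _).le
  split_ifs <;> norm_num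

lemma ofEdges_mono : Monotone (ofEdges (G := G)) := by
  intro S T h e
  simp only [ofEdges, Bool.le_iff_imp, decide_eq_true_eq]
  exact fun he => h he

open Classical in
lemma indicator_monotone {A : Set (Config G)} (hA : IsUpperSet A) :
    Monotone fun S : Finset G.edgeSet => if ofEdges S ∈ A then (1 : ℝ) else 0 := by
  intro S T h
  dsimp only
  by_cases hS : ofEdges S ∈ A
  · rw [if_pos hS, if_pos (hA (ofEdges_mono h) hS)]
  · rw [if_neg hS]
    split_ifs <;> norm_num

open Classical in
lemma indicator_nonneg (A : Set (Config G)) :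
    0 ≤ fun S : Finset G.edgeSet => if ofEdges S ∈ A then (1 : ℝ) else 0 := by
  intro S
  dsimp only [Pi.zero_apply]
  split_ifs <;> norm_num

/-- FK-Ising measures with free boundary condition increase with the subgraph. -/
lemma fkIsingOn_mono {H H' : G.Subgraph} [Finite H.verts] [Finite H'.verts] (h : H ≤ H') (p : I)
    {A : Set (Config G)} (hA : MeasurableSet A) (hup : IsUpperSet A) :
    (fkIsingOn H p : Measure (Config G)).real A ≤
      (fkIsingOn H' p : Measure (Config G)).real A := by
  rw [fkIsingOn_real H p hA, fkIsingOn_real H' p hA]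
  refine sum_rankWeight_mono p.2 (fun e he => ?_) (indicator_nonneg A) (indicator_monotone hup)
  rw [mem_edgesOf] at he ⊢
  exact SimpleGraph.Subgraph.edgeSet_mono h he

instance (p : I) : IsProbabilityMeasure (bernoulli G p) := by
  unfold bernoulli
  infer_instance

/-- Two configurations that agree on `E` are both in `A` or both outside `A`. -/
def DeterminedBy (A : Set (Config G)) (E : Finset G.edgeSet) : Prop :=
  ∀ ω ω' : Config G, (∀ e ∈ E, ω e = ω' e) → ω ∈ A → ω' ∈ A

open Classical in
lemma bernoulli_real (p : I) {E : Finset G.edgeSet} {A : Set (Config G)}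
    (hA : DeterminedBy A E) :
    (bernoulli G p).real A = ∑ S ∈ E.powerset, bernoulliWeight p E S *
        (if ofEdges S ∈ A then 1 else 0) := by
  -- `A` is a finite disjoint union of boxes, one for each pattern of states on `E` that forces `A`.
  have hunion : A = ⋃ S ∈ E.powerset.filter (fun S => ofEdges S ∈ A),
      Set.pi E (fun e => {decide (e ∈ S)}) := by
    ext ω
    simp only [Set.mem_iUnion, Finset.mem_filter, Finset.mem_powerset, Set.mem_pi,
      Set.mem_singleton_iff, exists_prop, Finset.mem_coe]
    constructor
    · intro hω
      refine ⟨E.filter (fun e => ω e = true), ⟨Finset.filter_subset _ _, hA ω _ ?_ hω⟩, ?_⟩ <;>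
      · intro e he
        simp [ofEdges, he]
    · rintro ⟨S, ⟨_, hSA⟩, hS⟩
      exact hA _ _ (fun e he => by rw [hS e he]; simp [ofEdges]) hSA
  have hpi : ∀ S ∈ E.powerset, (bernoulli G p).real (Set.pi E (fun e => {decide (e ∈ S)})) =
      bernoulliWeight p E S := by
    intro S hS
    rw [bernoulli, measureReal_def, Measure.infinitePi_pi _ (fun _ _ => MeasurableSet.of_discrete),
      ENNReal.toReal_prod]
    have : ∀ e ∈ E, (bernoulliMeasure true false p {decide (e ∈ S)}).toReal =
        if e ∈ S then (p : ℝ) else 1 - p := by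
      intro e _
      by_cases h : e ∈ S <;> simp [h, bernoulliMeasure_def]
    rw [Finset.prod_congr rfl this, Finset.prod_ite, Finset.prod_const, Finset.prod_const,
      bernoulliWeight, Finset.filter_mem_eq_inter,
      Finset.inter_eq_right.2 (Finset.mem_powerset.1 hS)]
    congr! 3
    ext
    simp
  conv_lhs => rw [hunion]
  rw [measureReal_biUnion_finset]
  · rw [Finset.sum_filter]
    refine Finset.sum_congr rfl fun S hS => ?_
    rw [hpi S hS]
    split_ifs <;> simp
  · intro S hS T hT hST
    rw [Function.onFun, Set.disjoint_left]
    intro ω h1 h2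
    refine hST (Finset.ext fun e => ?_)
    simp only [Finset.coe_filter, Set.mem_ofPred_eq, Finset.mem_powerset] at hS hT
    by_cases he : e ∈ E
    · have h1 := h1 e he
      have h2 := h2 e he
      simp only [Set.mem_singleton_iff] at h1 h2
      simpa using h1.symm.trans h2
    · exact ⟨fun h => absurd (hS.1 h) he, fun h => absurd (hT.1 h) he⟩
  · intro S _
    exact MeasurableSet.pi (Set.to_countable _) (fun _ _ => MeasurableSet.of_discrete)

/-- The FK-Ising measure dominates Bernoulli percolation of parameter `p / (2 - p)`. -/
lemma bernoulli_le_fkIsingOn (H : G.Subgraph) [Finite H.verts] (p t : I)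
    (ht : (t : ℝ) = p / (2 - p)) {A : Set (Config G)} (hA : MeasurableSet A)
    (hup : IsUpperSet A) (hdet : DeterminedBy A (edgesOf H)) :
    (bernoulli G t).real A ≤ (fkIsingOn H p : Measure (Config G)).real A := by
  rw [fkIsingOn_real H p hA, bernoulli_real t hdet, ht]
  exact sum_bernoulliWeight_le p.2 _ (indicator_nonneg A) (indicator_monotone hup)

end FiniteMeasures

end Percolation

namespace Percolation

/-! ### The free FK-Ising measure -/

section FreeMeasure

variable {V : Type*} {G : SimpleGraph V}

/-- The event that all edges of `S` are open. -/
def allOpen (S : Finset G.edgeSet) : Set (Config G) := {ω | ∀ e ∈ S, ω e = true}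

lemma isUpperSet_allOpen (S : Finset G.edgeSet) : IsUpperSet (allOpen S) :=
  fun _ _ h hω e he => Bool.le_iff_imp.1 (h e) (hω e he)

lemma isClopen_allOpen (S : Finset G.edgeSet) : IsClopen (allOpen S) := by
  have : allOpen S = ⋂ e ∈ S, (fun ω : Config G => ω e) ⁻¹' {true} := by
    ext
    simp [allOpen]
  rw [this]
  exact S.finite_toSet.isClopen_biInter fun e _ =>
    (isClopen_discrete _).preimage (continuous_apply e)

/-- Each vertex and edge of `K` enters at some stage and stays by monotonicity; there are finitely
many of them. -/
lemma eventually_le_of_iSup_eq_top {H : ℕ → G.Subgraph} (hmono : Monotone H) (htop : ⨆ n, H n = ⊤)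
    (K : G.Subgraph) (hK : K.verts.Finite) : ∀ᶠ n in atTop, K ≤ H n := by
  have hv : ∀ v, ∀ᶠ n in atTop, v ∈ (H n).verts := by
    intro v
    have : v ∈ (⨆ n, H n).verts := by simp [htop]
    rw [SimpleGraph.Subgraph.verts_iSup, Set.mem_iUnion] at this
    obtain ⟨n, hn⟩ := this
    filter_upwards [eventually_ge_atTop n] with m hm using (hmono hm).1 hn
  have he : ∀ u v, K.Adj u v → ∀ᶠ n in atTop, (H n).Adj u v := by
    intro u v huv
    have : (⨆ n, H n).Adj u v := by simpa [htop] using K.adj_sub huv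
    rw [SimpleGraph.Subgraph.iSup_adj] at this
    obtain ⟨n, hn⟩ := this
    filter_upwards [eventually_ge_atTop n] with m hm using (hmono hm).2 hn
  have h1 : ∀ᶠ n in atTop, ∀ v ∈ K.verts, v ∈ (H n).verts :=
    (eventually_all_finite hK).2 fun v _ => hv v
  have h2 : ∀ᶠ n in atTop, ∀ u ∈ K.verts, ∀ v ∈ K.verts, K.Adj u v → (H n).Adj u v :=
    (eventually_all_finite hK).2 fun u _ => (eventually_all_finite hK).2 fun v _ => by
      by_cases huv : K.Adj u v
      · filter_upwards [he u v huv] with n hn using fun _ => hn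
      · exact Eventually.of_forall fun n h => absurd h huv
  filter_upwards [h1, h2] with n hn1 hn2
  exact ⟨hn1, fun u v h => hn2 u (K.edge_vert h) v (K.edge_vert h.symm) h⟩

variable [Countable V]

/-- The events `allOpen S` form a π-system that generates the product `σ`-algebra. -/
lemma probabilityMeasure_ext {μ ν : ProbabilityMeasure (Config G)}
    (h : ∀ S, (μ : Measure (Config G)).real (allOpen S) = (ν : Measure (Config G)).real (allOpen S)) :
    μ = ν := by
  apply Subtype.ext
  have : IsFiniteMeasure (μ.1) := inferInstanceAs (IsFiniteMeasure (μ : Measure (Config G)))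
  refine ext_of_generate_finite (Set.range (allOpen (G := G))) (le_antisymm ?_ ?_) ?_ ?_ (by simp)
  · refine iSup_le fun e => ?_
    rw [← measurable_iff_comap_le]
    refine @measurable_to_bool _ (_) _ (MeasurableSpace.measurableSet_generateFrom ⟨{e}, ?_⟩)
    ext
    simp [allOpen]
  · refine MeasurableSpace.generateFrom_le ?_
    rintro _ ⟨S, rfl⟩
    exact (isClopen_allOpen S).isOpen.measurableSet
  · rintro _ ⟨S, rfl⟩ _ ⟨T, rfl⟩ -
    classical
    refine ⟨S ∪ T, ?_⟩
    ext ω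
    simp only [allOpen, Finset.mem_union, Set.mem_ofPred_eq, Set.mem_inter_iff]
    exact ⟨fun h => ⟨fun e he => h e (Or.inl he), fun e he => h e (Or.inr he)⟩,
      fun h e he => he.elim (h.1 e) (h.2 e)⟩
  · rintro _ ⟨S, rfl⟩
    have := h S
    rwa [measureReal_eq_measureReal_iff] at this

lemma continuous_real_of_isClopen {A : Set (Config G)} (hA : IsClopen A) :
    Continuous fun μ : ProbabilityMeasure (Config G) => (μ : Measure (Config G)).real A := by
  rw [continuous_iff_continuousAt]
  intro μ
  have := ProbabilityMeasure.tendsto_measure_of_null_frontier_of_tendsto' (tendsto_id (x := 𝓝 μ))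
    (E := A) (by simp [hA.frontier_eq])
  exact (ENNReal.tendsto_toReal (measure_ne_top _ _)).comp this

/-- The supremum over finite subgraphs of the FK-Ising probability that `S` is open. -/
noncomputable def freeOpenProb (p : I) (S : Finset G.edgeSet) : ℝ :=
  ⨆ K : {K : G.Subgraph // Finite K.verts},
    haveI := K.2
    (fkIsingOn K.1 p : Measure (Config G)).real (allOpen S)

/-- Every finite subgraph is eventually contained in `H n`, so by monotonicity the limit is the
supremum over all finite subgraphs, whatever the sequence. -/
lemma tendsto_fkIsingOn_allOpen (p : I) (H : ℕ → G.Subgraph) [∀ n, Finite (H n).verts]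
    (hmono : Monotone H) (htop : ⨆ n, H n = ⊤) (S : Finset G.edgeSet) :
    Tendsto (fun n => (fkIsingOn (H n) p : Measure (Config G)).real (allOpen S)) atTop
      (𝓝 (freeOpenProb p S)) := by
  have hS := (isClopen_allOpen S).isOpen.measurableSet
  have hbdd : BddAbove (Set.range fun K : {K : G.Subgraph // Finite K.verts} =>
      haveI := K.2
      (fkIsingOn K.1 p : Measure (Config G)).real (allOpen S)) := by
    refine ⟨1, ?_⟩
    rintro _ ⟨K, rfl⟩
    exact measureReal_le_one
  have hne : Nonempty {K : G.Subgraph // Finite K.verts} := ⟨⟨H 0, inferInstance⟩⟩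
  refine tendsto_order.2 ⟨fun a ha => ?_, fun a ha => Eventually.of_forall fun n => ?_⟩
  · obtain ⟨⟨K, hK⟩, hKa⟩ := exists_lt_of_lt_ciSup ha
    filter_upwards [eventually_le_of_iSup_eq_top hmono htop K (Set.toFinite _)] with n hn
    exact hKa.trans_le (fkIsingOn_mono hn p hS (isUpperSet_allOpen S))
  · exact (le_ciSup hbdd ⟨H n, inferInstance⟩).trans_lt ha

/-- The space of probability measures is compact, so limits along ultrafilters exist; the
probabilities of `allOpen S` identify each of them as `μ`. -/
lemma tendsto_of_tendsto_allOpen {μs : ℕ → ProbabilityMeasure (Config G)}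
    {μ : ProbabilityMeasure (Config G)}
    (h : ∀ S, Tendsto (fun n => (μs n : Measure (Config G)).real (allOpen S)) atTop
      (𝓝 ((μ : Measure (Config G)).real (allOpen S)))) :
    Tendsto μs atTop (𝓝 μ) := by
  rw [tendsto_iff_ultrafilter]
  intro g hg
  obtain ⟨ν, -, hν⟩ := isCompact_univ.ultrafilter_le_nhds (g.map μs) (by simp)
  have : ν = μ := probabilityMeasure_ext fun S => tendsto_nhds_unique
    (((continuous_real_of_isClopen (isClopen_allOpen S)).tendsto ν).comp hν) ((h S).mono_left hg)
  exact this ▸ hν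

variable (G) in
lemma exists_exhaustion : ∃ H : ℕ → G.Subgraph, (∀ n, Finite (H n).verts) ∧ Monotone H ∧
    ⨆ n, H n = ⊤ := by
  obtain ⟨f, hf⟩ := exists_injective_nat V
  refine ⟨fun n => (⊤ : G.Subgraph).induce {v | f v < n}, fun n => ?_, fun m n hmn => ?_, ?_⟩
  · exact Set.Finite.preimage hf.injOn (Set.finite_lt_nat n)
  · exact SimpleGraph.Subgraph.induce_mono_right fun v (hv : f v < m) => hv.trans_le hmn
  · rw [eq_top_iff]
    refine ⟨fun v _ => ?_, fun u v huv => ?_⟩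
    · rw [SimpleGraph.Subgraph.verts_iSup, Set.mem_iUnion]
      exact ⟨f v + 1, Nat.lt_succ_self _⟩
    · rw [SimpleGraph.Subgraph.iSup_adj]
      exact ⟨max (f u) (f v) + 1, Nat.lt_succ_of_le (le_max_left _ _),
        Nat.lt_succ_of_le (le_max_right _ _), huv⟩

variable (G) in
/-- The free FK-Ising measure of a countable graph exists and is unique. -/
theorem existsUnique_isFreeFKIsing (p : I) :
    ∃! μ : ProbabilityMeasure (Config G), IsFreeFKIsing G p μ := by
  obtain ⟨H, hfin, hmono, htop⟩ := exists_exhaustion G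
  -- The candidate is an ultrafilter limit along one exhaustion.
  obtain ⟨μ, -, hμ⟩ := isCompact_univ.ultrafilter_le_nhds
    ((hyperfilter ℕ).map fun n => fkIsingOn (H n) p) (by simp)
  have hval : ∀ S, (μ : Measure (Config G)).real (allOpen S) = freeOpenProb p S := fun S =>
    tendsto_nhds_unique
      (((continuous_real_of_isClopen (isClopen_allOpen S)).tendsto μ).comp hμ)
      ((tendsto_fkIsingOn_allOpen p H hmono htop S).mono_left Nat.hyperfilter_le_atTop)
  refine ⟨μ, ?_, fun ν hν => tendsto_nhds_unique (hν H hmono htop) ?_⟩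
  · intro K _ hK hKtop
    refine tendsto_of_tendsto_allOpen fun S => ?_
    rw [hval]
    exact tendsto_fkIsingOn_allOpen p K hK hKtop S
  · refine tendsto_of_tendsto_allOpen fun S => ?_
    rw [hval]
    exact tendsto_fkIsingOn_allOpen p H hmono htop S

/-- The free FK-Ising measure dominates Bernoulli percolation of parameter `p / (2 - p)` on
increasing cylinder events. -/
theorem bernoulli_le_of_isFreeFKIsing {p t : I} (ht : (t : ℝ) = p / (2 - p))
    {μ : ProbabilityMeasure (Config G)} (hμ : IsFreeFKIsing G p μ) {A : Set (Config G)}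
    (hA : IsClopen A) (hup : IsUpperSet A) {E : Finset G.edgeSet} (hdet : DeterminedBy A E) :
    (bernoulli G t).real A ≤ (μ : Measure (Config G)).real A := by
  obtain ⟨H, hfin, hmono, htop⟩ := exists_exhaustion G
  refine ge_of_tendsto (((continuous_real_of_isClopen hA).tendsto μ).comp (hμ H hmono htop)) ?_
  have hE : ∀ᶠ n in atTop, ∀ e ∈ E, e ∈ edgesOf (H n) := by
    refine (eventually_all_finset E).2 fun e _ => ?_
    obtain ⟨⟨u, v⟩, he⟩ := e
    filter_upwards [eventually_le_of_iSup_eq_top hmono htop (G.subgraphOfAdj he)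
      (Set.toFinite {u, v})] with n hn
    rw [mem_edgesOf]
    exact hn.2 rfl
  filter_upwards [hE] with n hn
  exact bernoulli_le_fkIsingOn (H n) p t ht hA.isOpen.measurableSet hup
    fun ω ω' h => hdet ω ω' fun e he => h e (hn e he)

end FreeMeasure

end Percolation

namespace Percolation

/-! ### Geodesic cycles from antipodal distances -/

section GeodesicCycles

variable {V : Type*} {Γ : SimpleGraph V}

lemma exists_walk_of_adj (n : ℕ) (f : ℕ → V) (h : ∀ i < n, Γ.Adj (f i) (f (i + 1))) :
    ∃ w : Γ.Walk (f 0) (f n), w.length = n ∧ ∀ i ≤ n, w.getVert i = f i := by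
  induction n generalizing f with
  | zero => exact ⟨.nil, rfl, fun i hi => by simp [Nat.le_zero.1 hi]⟩
  | succ n ih =>
    obtain ⟨w, hw, hv⟩ := ih (fun i => f (i + 1)) fun i hi => h (i + 1) (by omega)
    refine ⟨.cons (h 0 (by omega)) w, by simp [hw], fun i hi => ?_⟩
    cases i with
    | zero => simp
    | succ i => simpa using hv i (by omega)

lemma exists_subwalk {u v : V} (w : Γ.Walk u v) {i j : ℕ} (hij : i ≤ j) (hj : j ≤ w.length) :
    ∃ p : Γ.Walk (w.getVert i) (w.getVert j), p.length = j - i := by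
  obtain ⟨p, hp, -⟩ := exists_walk_of_adj (j - i) (fun k => w.getVert (i + k))
    fun k hk => w.adj_getVert_succ (by omega)
  have : i + (j - i) = j := by omega
  exact ⟨p.copy (by simp) (by simp [this]), by simpa using hp⟩

lemma dist_eq_of_forall_walk {a b : V} (p : Γ.Walk a b) {k : ℕ} (hp : p.length = k)
    (h : ∀ q : Γ.Walk a b, k ≤ q.length) : Γ.dist a b = k := by
  obtain ⟨q, hq⟩ := p.reachable.exists_walk_length_eq_dist
  exact le_antisymm (hp ▸ SimpleGraph.dist_le p) (hq ▸ h q)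

/-- A closed walk of length `2 * m` whose antipodal points are at distance `m` is a geodesic
cycle. -/
theorem isGeodesicCycle_of_antipodal {o : V} (w : Γ.Walk o o) {m : ℕ} (hm : 2 ≤ m)
    (hlen : w.length = 2 * m)
    (h : ∀ i ≤ m, ∀ q : Γ.Walk (w.getVert i) (w.getVert (i + m)), m ≤ q.length) :
    IsGeodesicCycle Γ w := by
  have hgeo : ∀ i j : ℕ, i ≤ j → j ≤ w.length →
      Γ.dist (w.getVert i) (w.getVert j) = j - i ∨
      Γ.dist (w.getVert i) (w.getVert j) = w.length - (j - i) := by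
    intro i j hij hj
    by_cases hd : j - i ≤ m
    · left
      obtain ⟨p, hp⟩ := exists_subwalk w hij hj
      refine dist_eq_of_forall_walk p hp fun q => ?_
      -- A short arc extends to a half of the cycle, from `i` to `i + m` or from `j - m` to `j`; a
      -- shortcut would bring antipodal points too close.
      by_cases hi : i ≤ m
      · obtain ⟨r, hr⟩ := exists_subwalk w (show j ≤ i + m by omega) (by omega)
        have := h i hi (q.append r)
        rw [SimpleGraph.Walk.length_append] at this
        omega
      · obtain ⟨r, hr⟩ := exists_subwalk w (show j - m ≤ i by omega) (by omega)
        have := h (j - m) (by omega) ((r.append q).copy rfl (by congr 1; omega))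
        rw [SimpleGraph.Walk.length_copy, SimpleGraph.Walk.length_append] at this
        omega
    · right
      obtain ⟨p, hp⟩ := exists_subwalk w (Nat.zero_le i) (by omega)
      obtain ⟨r, hr⟩ := exists_subwalk w hj le_rfl
      refine dist_eq_of_forall_walk
        ((p.reverse.copy rfl w.getVert_zero).append (r.reverse.copy w.getVert_length rfl)) ?_ fun q => ?_
      · simp only [SimpleGraph.Walk.length_append, SimpleGraph.Walk.length_copy,
          SimpleGraph.Walk.length_reverse]
        omega
      -- Going back from `j` to the antipode `i + m` of `i` takes `j - i - m` steps, so `q` has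
      -- length at least `2 * m - (j - i)`.
      · obtain ⟨s, hs⟩ := exists_subwalk w (show i + m ≤ j by omega) hj
        have := h i (by omega) (q.append s.reverse)
        rw [SimpleGraph.Walk.length_append, SimpleGraph.Walk.length_reverse] at this
        omega
  refine ⟨?_, hgeo⟩
  rw [SimpleGraph.Walk.isCycle_iff_isPath_tail_and_le_length]
  refine ⟨?_, by omega⟩
  have hnn : ¬ w.Nil := fun hn => by
    have := SimpleGraph.Walk.length_eq_zero_iff.2 hn
    omega
  -- Index `0` is excluded because it repeats at `2 * m`; otherwise both arcs have positive length,
  -- so the distance is positive.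
  have hne : ∀ i j : ℕ, 1 ≤ i → i < j → j ≤ w.length → w.getVert i ≠ w.getVert j := by
    intro i j hi hij hj heq
    have := hgeo i j hij.le hj
    rw [heq, SimpleGraph.dist_self] at this
    omega
  rw [← SimpleGraph.Walk.IsPath.getVert_injOn_iff]
  have hl := SimpleGraph.Walk.length_tail_add_one hnn
  intro i hi j hj hij
  rw [SimpleGraph.Walk.getVert_tail, SimpleGraph.Walk.getVert_tail] at hij
  simp only [Set.mem_ofPred_eq] at hi hj
  rcases lt_trichotomy i j with hlt | heq | hgt
  · exact absurd hij (hne _ _ (by omega) (by omega) (by omega))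
  · exact heq
  · exact absurd hij.symm (hne _ _ (by omega) (by omega) (by omega))

lemma ncard_edgeSet_of_isCycle {o : V} {w : Γ.Walk o o} (hw : w.IsCycle) :
    w.edgeSet.ncard = w.length := by
  classical
  have : w.edgeSet = (w.edges.toFinset : Set (Sym2 V)) := by
    ext
    simp [SimpleGraph.Walk.edgeSet]
  rw [this, Set.ncard_coe_finset, List.toFinset_card_of_nodup hw.edges_nodup,
    SimpleGraph.Walk.length_edges]

/-- Antipodal distances in the whole graph make a closed walk of a subgraph a geodesic cycle of
both graphs. -/
theorem mem_geodesicCycles_inter {G : SimpleGraph V} (hΓ : Γ ≤ G) {f : ℕ → V} {m : ℕ} (hm : 2 ≤ m)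
    (hclosed : f (2 * m) = f 0) (hadj : ∀ i < 2 * m, Γ.Adj (f i) (f (i + 1)))
    (h : ∀ i ≤ m, ∀ q : G.Walk (f i) (f (i + m)), m ≤ q.length) :
    ∃ C ∈ geodesicCycles G (f 0) ∩ geodesicCycles Γ (f 0), C.ncard = 2 * m := by
  obtain ⟨w, hw, hv⟩ := exists_walk_of_adj (2 * m) f hadj
  obtain ⟨w', hw', hv'⟩ : ∃ w' : Γ.Walk (f 0) (f 0), w'.length = 2 * m ∧
      ∀ i ≤ 2 * m, w'.getVert i = f i := ⟨w.copy rfl hclosed, by simpa using hw, by simpa using hv⟩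
  have h1 : IsGeodesicCycle Γ w' := isGeodesicCycle_of_antipodal w' hm hw' fun i hi q => by
    have := h i hi ((q.mapLe hΓ).copy (hv' i (by omega)) (hv' (i + m) (by omega)))
    simpa using this
  have h2 : IsGeodesicCycle G (w'.mapLe hΓ) :=
    isGeodesicCycle_of_antipodal _ hm (by simpa using hw') fun i hi q => by
      have := h i hi (q.copy (by simpa using hv' i (by omega))
        (by simpa using hv' (i + m) (by omega)))
      simpa using this
  exact ⟨w'.edgeSet, ⟨⟨_, h2, by ext; simp [SimpleGraph.Walk.edgeSet]⟩, ⟨_, h1, rfl⟩⟩,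
    (ncard_edgeSet_of_isCycle h1.1).trans hw'⟩

end GeodesicCycles

end Percolation

namespace DiestelLeader

/-! ### Geodesic cycles in the Diestel-Leader graph -/

/-- The child of a vertex with new digit `b`. -/
def child (b : Bool) (v : TreeVertex) : TreeVertex :=
  ⟨(v.1.1 - 1, if b then insert (v.1.1 - 1) v.1.2 else v.1.2), fun k hk => by
    dsimp only at hk ⊢
    split_ifs at hk
    · rcases Finset.mem_insert.1 hk with rfl | hk
      · exact le_rfl
      · have := v.2 k hk
        omega
    · have := v.2 k hk
      omega⟩

@[simp] lemma height_child (b : Bool) (v : TreeVertex) : height (child b v) = height v - 1 := rfl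

lemma mem_digits_child {b : Bool} {v : TreeVertex} {j : ℤ} :
    j ∈ (child b v).1.2 ↔ (b = true ∧ j = height v - 1) ∨ j ∈ v.1.2 := by
  cases b <;> simp [child, height]

lemma le_of_mem_digits {v : TreeVertex} {j : ℤ} (h : j ∈ v.1.2) : height v ≤ j := v.2 j h

lemma treeVertex_ext {v w : TreeVertex} (h : height v = height w)
    (hd : ∀ j, j ∈ v.1.2 ↔ j ∈ w.1.2) : v = w :=
  Subtype.ext (Prod.ext h (Finset.ext hd))

@[simp] lemma parent_child (b : Bool) (v : TreeVertex) : parent (child b v) = v := by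
  refine treeVertex_ext (by simp) fun j => ?_
  have := mem_digits_iterate_parent 1 (child b v) j
  rw [Function.iterate_one] at this
  rw [this, mem_digits_child, height_child]
  constructor
  · rintro ⟨⟨-, h⟩ | h, h'⟩
    · push_cast at h'
      omega
    · exact h
  · intro h
    have := le_of_mem_digits h
    exact ⟨Or.inr h, by push_cast; omega⟩

lemma child_injective (v : TreeVertex) : Function.Injective fun b => child b v := by
  intro b b' h
  have h : (child b v).1.2 = (child b' v).1.2 := by
    rw [show child b v = child b' v from h]
  have h := Finset.ext_iff.1 h (height v - 1)
  have hn : height v - 1 ∉ v.1.2 := fun h => by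
    have := le_of_mem_digits h
    omega
  simp only [mem_digits_child, hn, and_true, or_false] at h
  rwa [Bool.eq_iff_iff]

/-- Moving up in the first tree and down in the second. -/
def step (b : Bool) (u : DLVertex) : DLVertex :=
  ⟨(parent u.1.1, child b u.1.2), by
    have := u.2
    simp only [height_parent, height_child]
    omega⟩

lemma adj_step (b : Bool) (u : DLVertex) : DL.Adj u (step b u) :=
  ⟨Or.inl rfl, Or.inr (parent_child b u.1.2).symm⟩

/-- The path that starts at `u` and moves up in the first tree, and down along the digits `β` in the
second. -/
def stepPath (β : ℕ → Bool) (u : DLVertex) : ℕ → DLVertex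
  | 0 => u
  | k + 1 => step (β k) (stepPath β u k)

lemma stepPath_fst (β : ℕ → Bool) (u : DLVertex) (k : ℕ) :
    (stepPath β u k).1.1 = parent^[k] u.1.1 := by
  induction k with
  | zero => rfl
  | succ k ih =>
    rw [Function.iterate_succ_apply', ← ih]
    rfl

lemma stepPath_snd_congr (β : ℕ → Bool) {u v : DLVertex} (h : u.1.2 = v.1.2) (k : ℕ) :
    (stepPath β u k).1.2 = (stepPath β v k).1.2 := by
  induction k with
  | zero => exact h
  | succ k ih =>
    change child _ _ = child _ _
    rw [ih]

lemma height_stepPath_fst (β : ℕ → Bool) (u : DLVertex) (k : ℕ) :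
    height (stepPath β u k).1.1 = height u.1.1 + k := by
  rw [stepPath_fst, height_iterate_parent]

/-- The first step writes `β 0` at this index; later steps write only at lower indices. -/
lemma stepPath_snd_digit (β : ℕ → Bool) (u : DLVertex) (k : ℕ) :
    height u.1.2 - 1 ∈ (stepPath β u (k + 1)).1.2.1.2 ↔ β 0 = true := by
  induction k with
  | zero =>
    change _ ∈ (child (β 0) u.1.2).1.2 ↔ _
    rw [mem_digits_child]
    have : height u.1.2 - 1 ∉ u.1.2.1.2 := fun h => by
      have := le_of_mem_digits h
      omega
    simp [this]
  | succ k ih =>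
    change _ ∈ (child (β (k + 1)) (stepPath β u (k + 1)).1.2).1.2 ↔ _
    rw [mem_digits_child, ih]
    have h1 := (stepPath β u (k + 1)).2
    have h2 := height_stepPath_fst β u (k + 1)
    have h3 := u.2
    push_cast at h2
    constructor
    · rintro (⟨-, h⟩ | h)
      · omega
      · exact h
    · exact Or.inr

/-- An edge can change only the digit at the height of its lower end, which is below `j` here. -/
lemma mem_digits_iff_of_adj {x y : TreeVertex} (h : tree.Adj x y) {j : ℤ} (hx : height x ≤ j)
    (hy : height y ≤ j) : j ∈ x.1.2 ↔ j ∈ y.1.2 := by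
  have key : ∀ x : TreeVertex, height (parent x) ≤ j → (j ∈ x.1.2 ↔ j ∈ (parent x).1.2) := by
    intro x hx
    have := mem_digits_iterate_parent 1 x j
    rw [Function.iterate_one] at this
    rw [height_parent] at hx
    rw [this]
    exact ⟨fun h => ⟨h, by exact_mod_cast hx⟩, fun h => h.1⟩
  rcases h with rfl | rfl
  · exact key x hy
  · exact (key y hx).symm

/-- A walk between vertices that differ in a digit of the coordinate `π` has to climb above
that digit. -/
lemma exists_height_gt_of_digit_ne (π : DLVertex → TreeVertex)
    (hπ : ∀ x y, DL.Adj x y → tree.Adj (π x) (π y)) {a b : DLVertex} (q : DL.Walk a b) {j : ℤ}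
    (h : ¬ (j ∈ (π a).1.2 ↔ j ∈ (π b).1.2)) :
    ∃ i ≤ q.length, j < height (π (q.getVert i)) := by
  induction q with
  | nil => exact absurd Iff.rfl h
  | @cons a c b hac q ih =>
    by_cases h1 : j < height (π a)
    · exact ⟨0, Nat.zero_le _, by simpa using h1⟩
    by_cases h2 : j < height (π c)
    · exact ⟨1, by simp, by simpa using h2⟩
    have := mem_digits_iff_of_adj (hπ _ _ hac) (not_lt.1 h1) (not_lt.1 h2)
    obtain ⟨i, hi, hj⟩ := ih (by rwa [← this])
    exact ⟨i + 1, by simpa using hi, by simpa using hj⟩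

lemma abs_height_sub_le {a b : DLVertex} (q : DL.Walk a b) {i j : ℕ} (hij : i ≤ j)
    (hj : j ≤ q.length) :
    height (q.getVert j).1.1 - height (q.getVert i).1.1 ≤ j - i ∧
    height (q.getVert i).1.1 - height (q.getVert j).1.1 ≤ j - i := by
  induction j, hij using Nat.le_induction with
  | base => simp
  | succ j hij ih =>
    have h1 := ih (by omega)
    have h2 := height_of_adj (q.adj_getVert_succ (show j < q.length by omega)).1
    push_cast
    omega

/-- In either order, visiting heights `c + n` and `c` and returning to `c + k` costs `(n - k) + n +
k`, since each step changes the height by one. -/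
lemma length_ge_of_visits {a b : DLVertex} (q : DL.Walk a b) {n k : ℕ} {c : ℤ}
    (ha : height a.1.1 = c + k) (hb : height b.1.1 = c + k)
    (h1 : ∃ i ≤ q.length, c + n ≤ height (q.getVert i).1.1)
    (h2 : ∃ i ≤ q.length, height (q.getVert i).1.1 ≤ c) : 2 * n ≤ q.length := by
  obtain ⟨i, hi, hi'⟩ := h1
  obtain ⟨j, hj, hj'⟩ := h2
  have a1 := abs_height_sub_le q (Nat.zero_le i) hi
  have a2 := abs_height_sub_le q (Nat.zero_le j) hj
  have a3 := abs_height_sub_le q hi le_rfl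
  have a4 := abs_height_sub_le q hj le_rfl
  rw [q.getVert_zero] at a1 a2
  rw [q.getVert_length] at a3 a4
  rcases le_total i j with hij | hij
  · have := abs_height_sub_le q hij hj
    omega
  · have := abs_height_sub_le q hij hi
    omega

/-- The vertices `u` and `v` agree in the second tree and are the ends of a path of length `2 * n`
through their common `n`-th ancestor in the first. -/
structure Opposite (n : ℕ) (u v : DLVertex) : Prop where
  snd_eq : u.1.2 = v.1.2
  digit_iff : ∀ j, height u.1.1 + n ≤ j → (j ∈ u.1.1.1.2 ↔ j ∈ v.1.1.1.2)
  digit_ne : ¬ (height u.1.1 + n - 1 ∈ u.1.1.1.2 ↔ height u.1.1 + n - 1 ∈ v.1.1.1.2)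

namespace Opposite

variable {n : ℕ} {u v : DLVertex}

lemma height_eq (h : Opposite n u v) : height u.1.1 = height v.1.1 := by
  have h1 := u.2
  have h2 := v.2
  have h3 := congrArg height h.snd_eq
  omega

lemma symm (h : Opposite n u v) : Opposite n v u where
  snd_eq := h.snd_eq.symm
  digit_iff j hj := (h.digit_iff j (h.height_eq ▸ hj)).symm
  digit_ne hd := h.digit_ne (h.height_eq ▸ hd.symm)

/-- After `n` steps the first coordinate has forgotten all digits in which `u` and `v` may differ.
-/
lemma stepPath_eq (h : Opposite n u v) (β : ℕ → Bool) : stepPath β u n = stepPath β v n := by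
  refine Subtype.ext (Prod.ext ?_ (stepPath_snd_congr β h.snd_eq n))
  refine treeVertex_ext ?_ fun j => ?_
  · rw [height_stepPath_fst, height_stepPath_fst, h.height_eq]
  · rw [stepPath_fst, stepPath_fst, mem_digits_iterate_parent, mem_digits_iterate_parent,
      ← h.height_eq]
    exact and_congr_left fun hj => h.digit_iff j hj

/-- The two discrepancies between the ends, one in each tree, force a visit to a high and to a low
level of the first tree. -/
lemma two_mul_le_length (h : Opposite n u v) {β β' : ℕ → Bool} (hβ : β 0 ≠ β' 0) {k : ℕ}
    (hk : k ≤ n) (q : DL.Walk (stepPath β u k) (stepPath β' v k)) : 2 * n ≤ q.length := by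
  have h0 := h.height_eq
  refine length_ge_of_visits q (height_stepPath_fst β u k)
    (h0 ▸ height_stepPath_fst β' v k) ?_ ?_
  -- For `k = n` the separating digit of the first tree is already forgotten, but the walk starts at
  -- the required height.
  · rcases hk.eq_or_lt with rfl | hk
    · exact ⟨0, Nat.zero_le _, by rw [q.getVert_zero, height_stepPath_fst]⟩
    · obtain ⟨i, hi, hj⟩ := exists_height_gt_of_digit_ne (fun x => x.1.1) (fun _ _ h => h.1) q
        (j := height u.1.1 + n - 1) (by
          rw [stepPath_fst, stepPath_fst, mem_digits_iterate_parent, mem_digits_iterate_parent,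
            ← h0]
          have : height u.1.1 + k ≤ height u.1.1 + n - 1 := by omega
          simpa only [this, and_true] using h.digit_ne)
      exact ⟨i, hi, by omega⟩
  -- For `k = 0` no digit has been written yet, but the walk starts at the low level. Otherwise,
  -- climbing in the second tree means descending in the first.
  · cases k with
    | zero => exact ⟨0, Nat.zero_le _, by rw [q.getVert_zero]; exact le_rfl⟩
    | succ k =>
      obtain ⟨i, hi, hj⟩ := exists_height_gt_of_digit_ne (fun x => x.1.2) (fun _ _ h => h.2) q
        (j := height u.1.2 - 1) (by
          rw [stepPath_snd_digit]
          rw [h.snd_eq, stepPath_snd_digit]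
          intro hh
          exact hβ (Bool.eq_iff_iff.2 hh))
      have h1 := (q.getVert i).2
      have h2 := u.2
      exact ⟨i, hi, by omega⟩

/-- Four open paths between opposite vertices form a geodesic cycle. -/
theorem exists_geodesicCycle (h : Opposite n u v) (hn : 1 ≤ n) {β β' : ℕ → Bool}
    (hβ : β 0 ≠ β' 0) {Γ : SimpleGraph DLVertex} (hΓ : Γ ≤ DL)
    (hadj : ∀ b ∈ ({β, β'} : Set (ℕ → Bool)), ∀ x ∈ ({u, v} : Set DLVertex), ∀ k < n,
      Γ.Adj (stepPath b x k) (stepPath b x (k + 1))) :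
    ∃ C ∈ Percolation.geodesicCycles DL u ∩ Percolation.geodesicCycles Γ u,
      C.ncard = 2 * (2 * n) := by
  -- The four quarters are: up from `u` along `β`, down to `v`, up from `v` along `β'`, down to `u`.
  set f : ℕ → DLVertex := fun i =>
    if i ≤ n then stepPath β u i else if i ≤ 2 * n then stepPath β v (2 * n - i)
    else if i ≤ 3 * n then stepPath β' v (i - 2 * n) else stepPath β' u (4 * n - i) with hf
  have f1 : ∀ i ≤ n, f i = stepPath β u i := fun i hi => if_pos hi
  have f2 : ∀ i, n ≤ i → i ≤ 2 * n → f i = stepPath β v (2 * n - i) := by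
    intro i h1 h2
    rcases h1.eq_or_lt with rfl | h1
    · rw [f1 n le_rfl, h.stepPath_eq]
      congr 1
      omega
    · simp [hf, h1.not_ge, h2]
  have f3 : ∀ i, 2 * n ≤ i → i ≤ 3 * n → f i = stepPath β' v (i - 2 * n) := by
    intro i h1 h2
    rcases h1.eq_or_lt with rfl | h1
    · rw [f2 _ (by omega) le_rfl, Nat.sub_self]
      rfl
    · simp [hf, h1.not_ge, h2, show ¬ i ≤ n by omega]
  have f4 : ∀ i, 3 * n ≤ i → f i = stepPath β' u (4 * n - i) := by
    intro i h1
    rcases h1.eq_or_lt with rfl | h1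
    · rw [f3 _ (by omega) le_rfl, show 3 * n - 2 * n = n by omega,
        show 4 * n - 3 * n = n by omega, h.stepPath_eq]
    · simp [hf, h1.not_ge, show ¬ i ≤ n by omega, show ¬ i ≤ 2 * n by omega]
  have h0 : f 0 = u := f1 0 (Nat.zero_le _)
  rw [← h0]
  refine Percolation.mem_geodesicCycles_inter hΓ (by omega) ?_ ?_ ?_
  · rw [f4 _ (by omega), h0, show 4 * n - 2 * (2 * n) = 0 by omega]
    rfl
  · intro i hi
    by_cases c1 : i < n
    · rw [f1 i c1.le, f1 (i + 1) c1]
      exact hadj β (by simp) u (by simp) i c1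
    by_cases c2 : i < 2 * n
    · rw [f2 i (by omega) c2.le, f2 (i + 1) (by omega) c2,
        show 2 * n - i = 2 * n - (i + 1) + 1 by omega]
      exact (hadj β (by simp) v (by simp) _ (by omega)).symm
    by_cases c3 : i < 3 * n
    · rw [f3 i (by omega) c3.le, f3 (i + 1) (by omega) c3,
        show i + 1 - 2 * n = i - 2 * n + 1 by omega]
      exact hadj β' (by simp) v (by simp) _ (by omega)
    · rw [f4 i (by omega), f4 (i + 1) (by omega), show 4 * n - i = 4 * n - (i + 1) + 1 by omega]
      exact (hadj β' (by simp) u (by simp) _ (by omega)).symm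
  · intro i hi
    -- The first quarter is antipodal to the third, and the second to the fourth; the latter is the
    -- same estimate with `u` and `v` exchanged.
    by_cases c1 : i ≤ n
    · rw [f1 i c1, f3 (i + 2 * n) (by omega) (by omega), Nat.add_sub_cancel]
      exact h.two_mul_le_length hβ c1
    · rw [f2 i (by omega) hi, f4 (i + 2 * n) (by omega),
        show 4 * n - (i + 2 * n) = 2 * n - i by omega]
      exact h.symm.two_mul_le_length hβ (by omega)

end Opposite

/-- Every vertex has an opposite one. -/
lemma exists_opposite (n : ℕ) (hn : 1 ≤ n) (u : DLVertex) : ∃ v, Opposite n u v := by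
  have hh := u.2
  refine ⟨⟨(⟨(height u.1.1, symmDiff u.1.1.1.2 {height u.1.1 + n - 1}), fun k hk => ?_⟩, u.1.2),
    hh⟩, rfl, fun j hj => ?_, ?_⟩
  · rw [Finset.mem_symmDiff, Finset.mem_singleton] at hk
    rcases hk with ⟨hk, -⟩ | ⟨rfl, -⟩
    · exact le_of_mem_digits hk
    · simp only
      omega
  · have : j ≠ height u.1.1 + n - 1 := by omega
    simp [Finset.mem_symmDiff, this]
  · simp [Finset.mem_symmDiff]

end DiestelLeader

namespace Percolation

/-! ### Independence and cylinder events -/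

section Cylinders

variable {V : Type*} {G : SimpleGraph V}

/-- The `σ`-algebra generated by the states of the edges in `S`. -/
abbrev edgeSigma (S : Set G.edgeSet) : MeasurableSpace (Config G) :=
  ⨆ e ∈ S, MeasurableSpace.comap (fun ω : Config G => ω e) inferInstance

lemma edgeSigma_mono {S T : Set G.edgeSet} (h : S ⊆ T) : edgeSigma S ≤ edgeSigma T :=
  biSup_mono h

lemma measurableSet_edgeSigma {S : Set G.edgeSet} {e : G.edgeSet} (he : e ∈ S) :
    MeasurableSet[edgeSigma S] {ω : Config G | ω e = true} :=
  le_biSup (fun e => MeasurableSpace.comap (fun ω : Config G => ω e) inferInstance) he _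
    ⟨{true}, MeasurableSet.of_discrete, rfl⟩

lemma bernoulli_real_inter (p : I) {S T : Set G.edgeSet} (hST : Disjoint S T)
    {A B : Set (Config G)} (hA : MeasurableSet[edgeSigma S] A)
    (hB : MeasurableSet[edgeSigma T] B) :
    (bernoulli G p).real (A ∩ B) = (bernoulli G p).real A * (bernoulli G p).real B := by
  have h : iIndepFun (fun (e : G.edgeSet) (ω : Config G) => ω e) (bernoulli G p) :=
    iIndepFun_infinitePi (X := fun _ x => x) fun _ => measurable_id
  have h2 := indep_iSup_of_disjoint (fun e => (measurable_pi_apply e).comap_le) h hST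
  have h3 := (Indep_iff _ _ _).1 h2 A B hA hB
  simp only [measureReal_def, h3, ENNReal.toReal_mul]

lemma bernoulli_real_open (p : I) (e : G.edgeSet) :
    (bernoulli G p).real {ω | ω e = true} = p := by
  have h := Measure.infinitePi_pi (μ := fun _ : G.edgeSet => bernoulliMeasure true false p)
    (s := {e}) (t := fun _ => {true}) fun _ _ => MeasurableSet.of_discrete
  have h2 : {ω : Config G | ω e = true} =
      Set.pi (({e} : Finset G.edgeSet) : Set G.edgeSet) fun _ => {true} := by
    ext
    simp
  rw [measureReal_def, h2, bernoulli, h]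
  simp [bernoulliMeasure_def]

/-- Increasing clopen events that are determined by finitely many edges. -/
structure IsIncreasingCylinder (A : Set (Config G)) : Prop where
  isClopen : IsClopen A
  isUpperSet : IsUpperSet A
  determined : ∃ E, DeterminedBy A E

lemma isIncreasingCylinder_univ : IsIncreasingCylinder (Set.univ : Set (Config G)) :=
  ⟨isClopen_univ, isUpperSet_univ, ∅, fun _ _ _ _ => trivial⟩

lemma isIncreasingCylinder_open (e : G.edgeSet) :
    IsIncreasingCylinder {ω : Config G | ω e = true} :=
  ⟨(isClopen_discrete {true}).preimage (continuous_apply e),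
    fun _ _ h hω => Bool.le_iff_imp.1 (h e) hω, {e}, fun _ _ h hω => (h e (by simp)).symm.trans hω⟩

lemma IsIncreasingCylinder.inter {A B : Set (Config G)} (hA : IsIncreasingCylinder A)
    (hB : IsIncreasingCylinder B) : IsIncreasingCylinder (A ∩ B) := by
  classical
  obtain ⟨E, hE⟩ := hA.determined
  obtain ⟨F, hF⟩ := hB.determined
  exact ⟨hA.isClopen.inter hB.isClopen, hA.isUpperSet.inter hB.isUpperSet, E ∪ F,
    fun ω ω' h hω => ⟨hE ω ω' (fun e he => h e (Finset.mem_union_left _ he)) hω.1,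
      hF ω ω' (fun e he => h e (Finset.mem_union_right _ he)) hω.2⟩⟩

lemma IsIncreasingCylinder.union {A B : Set (Config G)} (hA : IsIncreasingCylinder A)
    (hB : IsIncreasingCylinder B) : IsIncreasingCylinder (A ∪ B) := by
  classical
  obtain ⟨E, hE⟩ := hA.determined
  obtain ⟨F, hF⟩ := hB.determined
  exact ⟨hA.isClopen.union hB.isClopen, hA.isUpperSet.union hB.isUpperSet, E ∪ F,
    fun ω ω' h hω => hω.imp (hE ω ω' fun e he => h e (Finset.mem_union_left _ he))
      (hF ω ω' fun e he => h e (Finset.mem_union_right _ he))⟩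

end Cylinders

/-- A reverse Fatou lemma: events of probability at least `δ` occur infinitely often with
probability at least `δ`. -/
lemma le_measureReal_frequently {Ω : Type*} [MeasurableSpace Ω] (μ : Measure Ω)
    [IsProbabilityMeasure μ] {A : ℕ → Set Ω} (hA : ∀ n, MeasurableSet (A n)) {δ : ℝ}
    (h : ∀ n, δ ≤ μ.real (A n)) : δ ≤ μ.real {ω | ∃ᶠ n in atTop, ω ∈ A n} := by
  have heq : {ω | ∃ᶠ n in atTop, ω ∈ A n} = ⋂ n, ⋃ k ≥ n, A k := by
    ext
    simp [frequently_atTop]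
  have hanti : Antitone fun n => ⋃ k ≥ n, A k := fun m n hmn =>
    Set.biUnion_subset_biUnion_left fun k (hk : n ≤ k) => hmn.trans hk
  have ht := tendsto_measure_iInter_atTop (μ := μ)
    (fun n => (MeasurableSet.biUnion (Set.to_countable {k | k ≥ n})
      fun k _ => hA k).nullMeasurableSet) hanti ⟨0, measure_ne_top _ _⟩
  rw [heq]
  refine ge_of_tendsto' ((ENNReal.tendsto_toReal (measure_ne_top _ _)).comp ht) fun n => ?_
  exact (h n).trans (measureReal_mono (Set.subset_biUnion_of_mem (u := A) (le_refl n))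
    (measure_ne_top _ _))

end Percolation

namespace DiestelLeader

open Percolation

/-! ### Pairs of paths as a branching process -/

/-- The edge from `u` to `step b u`. -/
def stepEdge (b : Bool) (u : DLVertex) : DL.edgeSet := ⟨s(u, step b u), adj_step b u⟩

/-- A step raises the height in the first tree, so the unordered edge remembers its direction. -/
lemma stepEdge_inj {b b' : Bool} {u v : DLVertex} (h : stepEdge b u = stepEdge b' v) :
    u = v ∧ step b u = step b' v := by
  have h : s(u, step b u) = s(v, step b' v) := congrArg Subtype.val h
  rw [Sym2.eq_iff] at h
  refine h.resolve_right ?_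
  rintro ⟨h1, h2⟩
  have h1 := congrArg (fun x : DLVertex => height x.1.1) h1
  have h2 := congrArg (fun x : DLVertex => height x.1.1) h2
  simp only [step, height_parent] at h1 h2
  omega

/-- The edges from `u` and `v` in direction `b` are open. -/
def bothOpen (b : Bool) (u v : DLVertex) : Set (Config DL) :=
  {ω | ω (stepEdge b u) = true} ∩ {ω | ω (stepEdge b v) = true}

/-- There are parallel open paths of length `m` that start at `u` and `v`. -/
def linked : ℕ → DLVertex → DLVertex → Set (Config DL)
  | 0, _, _ => Set.univ
  | m + 1, u, v =>
    (bothOpen false u v ∩ linked m (step false u) (step false v)) ∪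
    (bothOpen true u v ∩ linked m (step true u) (step true v))

/-- There are parallel open paths of length `m + 1` from `u` and `v` with first step `b`. -/
def branch (b : Bool) (m : ℕ) (u v : DLVertex) : Set (Config DL) :=
  bothOpen b u v ∩ linked m (step b u) (step b v)

lemma linked_succ (m : ℕ) (u v : DLVertex) :
    linked (m + 1) u v = branch false m u v ∪ branch true m u v := rfl

lemma isIncreasingCylinder_bothOpen (b : Bool) (u v : DLVertex) :
    IsIncreasingCylinder (bothOpen b u v) :=
  (isIncreasingCylinder_open _).inter (isIncreasingCylinder_open _)

lemma isIncreasingCylinder_linked (m : ℕ) (u v : DLVertex) :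
    IsIncreasingCylinder (linked m u v) := by
  induction m generalizing u v with
  | zero => exact isIncreasingCylinder_univ
  | succ m ih =>
    exact ((isIncreasingCylinder_bothOpen _ _ _).inter (ih _ _)).union
      ((isIncreasingCylinder_bothOpen _ _ _).inter (ih _ _))

lemma isIncreasingCylinder_branch (b : Bool) (m : ℕ) (u v : DLVertex) :
    IsIncreasingCylinder (branch b m u v) :=
  (isIncreasingCylinder_bothOpen _ _ _).inter (isIncreasingCylinder_linked _ _ _)

/-! #### Paths in the open subgraph -/

lemma stepPath_succ (β : ℕ → Bool) (u : DLVertex) (k : ℕ) :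
    stepPath β u (k + 1) = stepPath (fun i => β (i + 1)) (step (β 0) u) k := by
  induction k with
  | zero => rfl
  | succ k ih =>
    change step (β (k + 1)) (stepPath β u (k + 1)) = _
    rw [ih]
    rfl

lemma exists_digits_of_mem_linked {ω : Config DL} {m : ℕ} {u v : DLVertex}
    (h : ω ∈ linked m u v) : ∃ β : ℕ → Bool, ∀ k < m, ω ∈ bothOpen (β k) (stepPath β u k)
      (stepPath β v k) := by
  induction m generalizing u v with
  | zero => exact ⟨fun _ => false, fun k hk => absurd hk (Nat.not_lt_zero k)⟩
  | succ m ih =>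
    obtain ⟨b, hb, hl⟩ : ∃ b, ω ∈ bothOpen b u v ∧ ω ∈ linked m (step b u) (step b v) := by
      rcases h with h | h
      · exact ⟨_, h⟩
      · exact ⟨_, h⟩
    obtain ⟨β, hβ⟩ := ih hl
    refine ⟨fun i => Nat.casesOn i b β, fun k hk => ?_⟩
    cases k with
    | zero => exact hb
    | succ k =>
      rw [stepPath_succ, stepPath_succ]
      exact hβ k (by omega)

lemma exists_digits_of_mem_branch {ω : Config DL} {b : Bool} {m : ℕ} {u v : DLVertex}
    (h : ω ∈ branch b m u v) : ∃ β : ℕ → Bool, β 0 = b ∧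
      ∀ x ∈ ({u, v} : Set DLVertex), ∀ k < m + 1,
        (openGraph DL ω).Adj (stepPath β x k) (stepPath β x (k + 1)) := by
  obtain ⟨β, hβ⟩ := exists_digits_of_mem_linked h.2
  have key : ∀ k < m + 1, ω ∈ bothOpen (Nat.casesOn k b β : Bool)
      (stepPath (fun i => Nat.casesOn i b β) u k) (stepPath (fun i => Nat.casesOn i b β) v k) := by
    intro k hk
    cases k with
    | zero => exact h.1
    | succ k =>
      rw [stepPath_succ, stepPath_succ]
      exact hβ k (by omega)
  refine ⟨fun i => Nat.casesOn i b β, rfl, fun x hx k hk => openGraph_adj.2 ⟨adj_step _ _, ?_⟩⟩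
  rcases hx with rfl | rfl
  · exact (key k hk).1
  · exact (key k hk).2

/-! #### Probabilities -/

/-- The edges whose upper end in the second tree descends from `y`. -/
def strictBelow (y : TreeVertex) : Set DL.edgeSet :=
  {e | ∃ b w, e = stepEdge b w ∧ ∃ j, parent^[j] w.1.2 = y}

/-- The edges whose lower end in the second tree descends from `y`. -/
def below (y : TreeVertex) : Set DL.edgeSet :=
  {e | ∃ b w, e = stepEdge b w ∧ ∃ j, parent^[j] (step b w).1.2 = y}

lemma below_child_subset (b : Bool) (y : TreeVertex) : below (child b y) ⊆ strictBelow y := by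
  rintro _ ⟨b', w, rfl, j, hj⟩
  refine ⟨b', w, rfl, j, ?_⟩
  have := congrArg parent hj
  rwa [parent_child, ← Function.iterate_succ_apply' parent, Function.iterate_succ_apply,
    show parent (step b' w).1.2 = w.1.2 from parent_child _ _] at this

lemma strictBelow_subset_below (y : TreeVertex) : strictBelow y ⊆ below y := by
  rintro _ ⟨b, w, rfl, j, hj⟩
  refine ⟨b, w, rfl, j + 1, ?_⟩
  rwa [Function.iterate_succ_apply, show parent (step b w).1.2 = w.1.2 from parent_child _ _]

lemma stepEdge_mem_below (b : Bool) (u : DLVertex) : stepEdge b u ∈ below (child b u.1.2) :=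
  ⟨b, u, rfl, 0, rfl⟩

/-- The lower end of an edge in the second tree has only one ancestor at a given height. -/
lemma disjoint_below_child (y : TreeVertex) :
    Disjoint (below (child false y)) (below (child true y)) := by
  rw [Set.disjoint_left]
  rintro _ ⟨b, w, rfl, j, hj⟩ ⟨b', w', h, j', hj'⟩
  rw [← (stepEdge_inj h).2] at hj'
  have h1 := congrArg height hj
  have h2 := congrArg height hj'
  rw [height_iterate_parent, height_child] at h1 h2
  obtain rfl : j = j' := by omega
  exact Bool.false_ne_true (child_injective y (hj.symm.trans hj'))

lemma stepEdge_notMem_strictBelow (b : Bool) (u : DLVertex) :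
    stepEdge b u ∉ strictBelow (child b u.1.2) := by
  rintro ⟨b', w, h, j, hj⟩
  rw [← (stepEdge_inj h).1] at hj
  have h1 := congrArg height hj
  rw [height_iterate_parent, height_child] at h1
  omega

lemma measurableSet_branch {m : ℕ} {b : Bool} {u v : DLVertex} (huv : u.1.2 = v.1.2)
    (h : MeasurableSet[edgeSigma (strictBelow (child b u.1.2))] (linked m (step b u) (step b v))) :
    MeasurableSet[edgeSigma (below (child b u.1.2))] (branch b m u v) :=
  ((measurableSet_edgeSigma (stepEdge_mem_below b u)).inter
    (measurableSet_edgeSigma (huv ▸ stepEdge_mem_below b v))).inter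
    (edgeSigma_mono (strictBelow_subset_below _) _ h)

/-- As `u` and `v` share their second coordinate, both parallel paths use only edges over the same
subtree. -/
lemma measurableSet_linked {m : ℕ} {u v : DLVertex} (huv : u.1.2 = v.1.2) :
    MeasurableSet[edgeSigma (strictBelow u.1.2)] (linked m u v) := by
  induction m generalizing u v with
  | zero => exact MeasurableSet.univ
  | succ m ih =>
    have h : ∀ b, MeasurableSet[edgeSigma (strictBelow u.1.2)] (branch b m u v) := fun b =>
      edgeSigma_mono (below_child_subset b _) _
        (measurableSet_branch huv (ih (congrArg (child b) huv)))
    exact (h false).union (h true)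

/-- The two first edges are distinct because `u ≠ v`, and they do not lie strictly below the child,
so they are independent of what follows. -/
lemma bernoulli_branch (p : I) {m : ℕ} {b : Bool} {u v : DLVertex} (huv : u.1.2 = v.1.2)
    (hne : u ≠ v) : (bernoulli DL p).real (branch b m u v) =
      (p : ℝ) ^ 2 * (bernoulli DL p).real (linked m (step b u) (step b v)) := by
  have h1 : Disjoint {stepEdge b u, stepEdge b v} (strictBelow (child b u.1.2)) := by
    rw [Set.disjoint_left]
    rintro _ (rfl | rfl)
    · exact stepEdge_notMem_strictBelow b u
    · exact huv ▸ stepEdge_notMem_strictBelow b v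
  have h2 : Disjoint {stepEdge b u} {stepEdge b v} :=
    Set.disjoint_singleton.2 fun h => hne (stepEdge_inj h).1
  have h3 : MeasurableSet[edgeSigma {stepEdge b u, stepEdge b v}] (bothOpen b u v) :=
    (measurableSet_edgeSigma (Set.mem_insert _ _)).inter
      (measurableSet_edgeSigma (Set.mem_insert_of_mem _ (Set.mem_singleton _)))
  have h4 : MeasurableSet[edgeSigma (strictBelow (child b u.1.2))]
      (linked m (step b u) (step b v)) :=
    measurableSet_linked (congrArg (child b) huv)
  have h5 : (bernoulli DL p).real (bothOpen b u v) = (p : ℝ) ^ 2 := by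
    rw [bothOpen, bernoulli_real_inter p h2 (measurableSet_edgeSigma (Set.mem_singleton _))
      (measurableSet_edgeSigma (Set.mem_singleton _)), bernoulli_real_open, bernoulli_real_open, sq]
  rw [branch, bernoulli_real_inter p h1 h3 h4, h5]

lemma bernoulli_branch_inter (p : I) {m : ℕ} {u v : DLVertex} (huv : u.1.2 = v.1.2) :
    (bernoulli DL p).real (branch false m u v ∩ branch true m u v) =
      (bernoulli DL p).real (branch false m u v) * (bernoulli DL p).real (branch true m u v) :=
  bernoulli_real_inter p (disjoint_below_child u.1.2)
    (measurableSet_branch huv (measurableSet_linked (congrArg (child _) huv)))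
    (measurableSet_branch huv (measurableSet_linked (congrArg (child _) huv)))

lemma Opposite.ne {n : ℕ} {u v : DLVertex} (h : Opposite n u v) : u ≠ v := by
  rintro rfl
  exact h.digit_ne Iff.rfl

/-- Each step uses up one level of separation. Starting from `n + 2` keeps the new pair distinct. -/
lemma Opposite.step {n : ℕ} {u v : DLVertex} (h : Opposite (n + 2) u v) (b : Bool) :
    Opposite (n + 1) (step b u) (step b v) := by
  have key : ∀ (x : DLVertex) (j : ℤ), height x.1.1 + 1 ≤ j →
      (j ∈ (DiestelLeader.step b x).1.1.1.2 ↔ j ∈ x.1.1.1.2) := by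
    intro x j hj
    have := mem_digits_iterate_parent 1 x.1.1 j
    rw [Function.iterate_one] at this
    change j ∈ (parent x.1.1).1.2 ↔ _
    rw [this]
    exact and_iff_left (by exact_mod_cast hj)
  have hh := h.height_eq
  have hs : height (DiestelLeader.step b u).1.1 = height u.1.1 + 1 := height_parent _
  refine ⟨congrArg (child b) h.snd_eq, fun j hj => ?_, ?_⟩
  · rw [hs] at hj
    push_cast at hj
    rw [key u j (by omega), key v j (by omega)]
    exact h.digit_iff j (by push_cast; omega)
  · rw [hs, key u _ (by push_cast; omega), key v _ (by push_cast; omega)]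
    have := h.digit_ne
    push_cast at this ⊢
    rwa [show height u.1.1 + 1 + ((n : ℤ) + 1) - 1 = height u.1.1 + ((n : ℤ) + 2) - 1 by ring]

/-- The branching process of parallel open paths survives with probability bounded below. -/
lemma le_bernoulli_linked (p : I) (hp : 1 < 2 * (p : ℝ) ^ 2) {m n : ℕ} (hmn : m ≤ n + 1)
    {u v : DLVertex} (h : Opposite (n + 1) u v) :
    2 * (p : ℝ) ^ 2 - 1 ≤ (bernoulli DL p).real (linked m u v) := by
  have hs1 : (p : ℝ) ^ 2 ≤ 1 := pow_le_one₀ p.2.1 p.2.2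
  induction m generalizing n u v with
  | zero =>
    rw [show linked 0 u v = Set.univ from rfl, probReal_univ]
    linarith
  | succ m ih =>
    have hq : ∀ b, 2 * (p : ℝ) ^ 2 - 1 ≤
        (bernoulli DL p).real (linked m (DiestelLeader.step b u) (DiestelLeader.step b v)) := by
      intro b
      cases n with
      -- The pair merges after this step, but then no further steps are required.
      | zero =>
        obtain rfl : m = 0 := by omega
        rw [show linked 0 _ _ = Set.univ from rfl, probReal_univ]
        linarith
      | succ n => exact ih (by omega) (h.step b)
    have hu := measureReal_union_add_inter (μ := bernoulli DL p) (s := branch false m u v)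
      (isIncreasingCylinder_branch true m u v).isClopen.isOpen.measurableSet
    rw [bernoulli_branch_inter p h.snd_eq, bernoulli_branch p h.snd_eq h.ne,
      bernoulli_branch p h.snd_eq h.ne, ← linked_succ] at hu
    have h0 := hq false
    have h1 := hq true
    have b0 : (bernoulli DL p).real (linked m (DiestelLeader.step false u)
      (DiestelLeader.step false v)) ≤ 1 := measureReal_le_one
    have b1 : (bernoulli DL p).real (linked m (DiestelLeader.step true u)
      (DiestelLeader.step true v)) ≤ 1 := measureReal_le_one
    set x := (bernoulli DL p).real (linked m (DiestelLeader.step false u)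
      (DiestelLeader.step false v))
    set y := (bernoulli DL p).real (linked m (DiestelLeader.step true u)
      (DiestelLeader.step true v))
    set s := (p : ℝ) ^ 2
    set c := 2 * s - 1 with hc
    -- By independence the two branches both fail with probability `(1 - s * x) * (1 - s * y)`.
    have e1 : (1 - s * x) * (1 - s * y) ≤ (1 - s * c) * (1 - s * c) := by
      have hs0 : 0 ≤ s := by linarith
      have := mul_le_mul_of_nonneg_left h0 hs0
      have := mul_le_mul_of_nonneg_left h1 hs0
      have : s * y ≤ 1 := mul_le_one₀ hs1 (by linarith) b1
      have : s * c ≤ 1 := mul_le_one₀ hs1 (by linarith) (by linarith)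
      exact mul_le_mul (by linarith) (by linarith) (by linarith) (by linarith)
    -- The choice `c = 2 * s - 1` makes the survival recursion map `c` to at least `c`, with excess
    -- `c ^ 2 * (1 - s ^ 2)`.
    have e2 : c ≤ 1 - (1 - s * c) * (1 - s * c) := by
      have : 1 - (1 - s * c) * (1 - s * c) - c = c * (c * (1 - s ^ 2)) := by
        rw [hc]
        ring
      have h3 : 0 ≤ c := by linarith
      have h4 : 0 ≤ 1 - s ^ 2 := by nlinarith
      have : 0 ≤ c * (c * (1 - s ^ 2)) := by positivity
      linarith
    nlinarith

/-! ### Cycle events and the conclusion -/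

/-- A vertex opposite to `u` at distance `2 * (n + 1)`. -/
noncomputable def oppositeVertex (n : ℕ) (u : DLVertex) : DLVertex :=
  (exists_opposite (n + 1) (Nat.succ_pos n) u).choose

lemma opposite_oppositeVertex (n : ℕ) (u : DLVertex) :
    Opposite (n + 1) u (oppositeVertex n u) :=
  (exists_opposite (n + 1) (Nat.succ_pos n) u).choose_spec

/-- Two pairs of parallel open paths with different first steps form a cycle through `u`. -/
def cycleEvent (n : ℕ) (u : DLVertex) : Set (Config DL) :=
  branch false n u (oppositeVertex n u) ∩ branch true n u (oppositeVertex n u)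

lemma isIncreasingCylinder_cycleEvent (n : ℕ) (u : DLVertex) :
    IsIncreasingCylinder (cycleEvent n u) :=
  (isIncreasingCylinder_branch _ _ _ _).inter (isIncreasingCylinder_branch _ _ _ _)

/-- The two branches are independent; what matters is that the bound does not depend on `n`. -/
lemma le_bernoulli_cycleEvent (p : I) (hp : 1 < 2 * (p : ℝ) ^ 2) (n : ℕ) (u : DLVertex) :
    ((p : ℝ) ^ 2 * (2 * (p : ℝ) ^ 2 - 1)) ^ 2 ≤ (bernoulli DL p).real (cycleEvent n u) := by
  have h := opposite_oppositeVertex n u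
  have hq : ∀ b, 2 * (p : ℝ) ^ 2 - 1 ≤ (bernoulli DL p).real
      (linked n (DiestelLeader.step b u) (DiestelLeader.step b (oppositeVertex n u))) := by
    intro b
    cases n with
    | zero =>
      rw [show linked 0 _ _ = Set.univ from rfl, probReal_univ]
      have : (p : ℝ) ^ 2 ≤ 1 := pow_le_one₀ p.2.1 p.2.2
      linarith
    | succ n => exact le_bernoulli_linked p hp le_rfl (h.step b)
  rw [cycleEvent, bernoulli_branch_inter p h.snd_eq, bernoulli_branch p h.snd_eq h.ne,
    bernoulli_branch p h.snd_eq h.ne, sq]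
  have hs : 0 ≤ (p : ℝ) ^ 2 := by positivity
  have hc : 0 ≤ 2 * (p : ℝ) ^ 2 - 1 := by linarith
  exact mul_le_mul (mul_le_mul_of_nonneg_left (hq false) hs)
    (mul_le_mul_of_nonneg_left (hq true) hs) (mul_nonneg hs hc) (by positivity)

/-- Cycles from different `n` have different numbers of edges, so infinitely many `n` yield
infinitely many cycles. -/
lemma frequently_cycleEvent_subset (u : DLVertex) :
    {ω | ∃ᶠ n in atTop, ω ∈ cycleEvent n u} ⊆ infinitelyManyGeodesicCycles DL u := by
  intro ω hω
  have hle : openGraph DL ω ≤ DL := fun x y h => (openGraph_adj.1 h).1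
  have hcyc : ∀ n, ω ∈ cycleEvent n u →
      ∃ C ∈ geodesicCycles DL u ∩ geodesicCycles (openGraph DL ω) u,
        C.ncard = 2 * (2 * (n + 1)) := by
    rintro n ⟨hf, ht⟩
    obtain ⟨β, hβ, hadj⟩ := exists_digits_of_mem_branch hf
    obtain ⟨β', hβ', hadj'⟩ := exists_digits_of_mem_branch ht
    refine (opposite_oppositeVertex n u).exists_geodesicCycle (Nat.succ_pos n) (β := β) (β' := β')
      (by simp [hβ, hβ']) hle ?_
    rintro b (rfl | rfl)
    · exact hadj
    · exact hadj'
  intro hfin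
  have hinf : {n | ω ∈ cycleEvent n u}.Infinite := Nat.frequently_atTop_iff_infinite.1 hω
  refine hinf (Set.Finite.subset ((hfin.image Set.ncard).preimage
    (f := fun n => 2 * (2 * (n + 1))) (fun a _ b _ h => ?_)) fun n hn => ?_)
  · simp only at h
    omega
  · obtain ⟨C, hC, hcard⟩ := hcyc n hn
    exact ⟨C, hC, hcard⟩

/-- A measure that dominates supercritical Bernoulli percolation on the cycle events has infinitely
many geodesic cycles with positive probability. -/
theorem infinitelyManyGeodesicCycles_pos {t : I} (ht : 1 < 2 * (t : ℝ) ^ 2) (u : DLVertex)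
    (μ : Measure (Config DL)) [IsProbabilityMeasure μ]
    (hμ : ∀ n, (bernoulli DL t).real (cycleEvent n u) ≤ μ.real (cycleEvent n u)) :
    0 < μ (infinitelyManyGeodesicCycles DL u) := by
  have h := le_measureReal_frequently μ
    (fun n => (isIncreasingCylinder_cycleEvent n u).isClopen.isOpen.measurableSet)
    fun n => (le_bernoulli_cycleEvent t ht n u).trans (hμ n)
  have hpos : 0 < ((t : ℝ) ^ 2 * (2 * (t : ℝ) ^ 2 - 1)) ^ 2 := by
    have h1 : 0 < (t : ℝ) ^ 2 := by linarith
    have h2 : 0 < 2 * (t : ℝ) ^ 2 - 1 := by linarith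
    positivity
  have h2 := hpos.trans_le h
  rw [measureReal_def] at h2
  exact (ENNReal.toReal_pos_iff.1 h2).1.trans_le (measure_mono (frequently_cycleEvent_subset u))

lemma one_lt_two_mul_sq {t : ℝ} (ht : 1 / √2 < t) : 1 < 2 * t ^ 2 := by
  have h2 : (0 : ℝ) < √2 := by positivity
  rw [div_lt_iff₀ h2] at ht
  have h3 : √2 ^ 2 = (2 : ℝ) := Real.sq_sqrt (by norm_num)
  have : 1 < (t * √2) ^ 2 := one_lt_pow₀ ht (by norm_num)
  rwa [mul_pow, h3, mul_comm] at this

end DiestelLeader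

theorem theorem1p1 (o : DiestelLeader.DLVertex) :
    (1 / √2 < (1 : ℝ) ∧ ∀ p : unitInterval, 1 / √2 < (p : ℝ) →
      0 < Percolation.bernoulli DiestelLeader.DL p
        (Percolation.infinitelyManyGeodesicCycles DiestelLeader.DL o)) ∧
    (2 / (√2 + 1) < (1 : ℝ) ∧ ∀ p : unitInterval, 2 / (√2 + 1) < (p : ℝ) →
      (∃! μ : MeasureTheory.ProbabilityMeasure (Percolation.Config DiestelLeader.DL),
        Percolation.IsFreeFKIsing DiestelLeader.DL p μ) ∧
      ∀ μ : MeasureTheory.ProbabilityMeasure (Percolation.Config DiestelLeader.DL),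
        Percolation.IsFreeFKIsing DiestelLeader.DL p μ →
          0 < (μ : MeasureTheory.Measure (Percolation.Config DiestelLeader.DL))
            (Percolation.infinitelyManyGeodesicCycles DiestelLeader.DL o)) := by
  have h2 : (1 : ℝ) < √2 := Real.lt_sqrt_of_sq_lt (by norm_num)
  refine ⟨⟨by rw [div_lt_one] <;> linarith, fun p hp =>
    DiestelLeader.infinitelyManyGeodesicCycles_pos (DiestelLeader.one_lt_two_mul_sq hp) o _
      fun _ => le_rfl⟩, by rw [div_lt_one] <;> linarith, fun p hp =>
    ⟨Percolation.existsUnique_isFreeFKIsing _ p, fun μ hμ => ?_⟩⟩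
  -- This is where the threshold `2 / (√2 + 1)` comes from: clearing denominators gives `2 < p * (√2
  -- + 1)`.
  have ht : 1 / √2 < (p : ℝ) / (2 - p) := by
    have := p.2.2
    rw [div_lt_iff₀ (by linarith)] at hp
    rw [div_lt_div_iff₀ (by linarith) (by linarith)]
    linarith
  refine DiestelLeader.infinitelyManyGeodesicCycles_pos
    (t := ⟨p / (2 - p), Percolation.div_two_sub_mem p.2⟩)
    (DiestelLeader.one_lt_two_mul_sq ht) o _ fun n => ?_
  have hcyl := DiestelLeader.isIncreasingCylinder_cycleEvent n o
  obtain ⟨E, hE⟩ := hcyl.determined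
  exact Percolation.bernoulli_le_of_isFreeFKIsing rfl hμ hcyl.isClopen hcyl.isUpperSet hE
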